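/- **Setting.** Roles and labels are natural numbers; $\tau$ ranges over payload types and $c$ over cost expressions. Global types are $$G ::= p\to q:\langle\tau\rhd c\rangle.G \mid p\to q:\{l.G_l\}_{l\in I} \mid \mu X.G \mid X \mid \mathsf{end},$$ with $p\neq q$ and $I$ a finite non-empty set of labels. They are closed, guarded and taken up to renaming of bound variables; $R=\mathrm{roles}(G)$ is the set of roles occurring in $G$. During execution there are three more forms: $p\rightsquigarrow q:\langle\tau\rhd c\rangle.G$ (sent, not yet received), $p\rightsquigarrow q:j\{l.G_l\}_{l\in I}$ with $j\in I$ (label $j$ sent, not yet received), and $p\leadsto(\tau\rhd c).G$ ($p$ is computing). Local types are $$L ::= p!\tau.L \mid p?\tau\rhd c.L \mid p\oplus\{l.L_l\}_{l\in I}\mid p\&\{l.L_l\}_{l\in I}\mid\mu X.L\mid X\mid\mathsf{end},$$ and during execution also $(\tau\rhd c).L$; at the head, a recursive local type is identified with its unfolding. **Projection** $G{\restriction}p$ is the following partial function. * $(q\to r:\langle\tau\rhd c\rangle.G){\restriction}p$ is $r!\tau.(G{\restriction}p)$ if $p=q\ne r$, is $q?\tau\rhd c.(G{\restriction}p)$ if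 $p=r\neq q$, and is $G{\restriction}p$ otherwise. * $(q\to r:\{l.G_l\}_{l\in I}){\restriction}p$ is $r\oplus\{l.G_l{\restriction}p\}_{l\in I}$ if $p=q\neq r$, is $q\&\{l.G_l{\restriction}p\}_{l\in I}$ if $p=r\neq q$, and is the merge $\sqcap_{l\in I}(G_l{\restriction}p)$ otherwise. * $(\mu X.G){\restriction}p$ is $\mu X.(G{\restriction}p)$ if $G{\restriction}p$ is not a recursion variable, and $\mathsf{end}$ if it is one; $X{\restriction}p=X$ and $\mathsf{end}{\restriction}p=\mathsf{end}$. The partial merge is given by $L\sqcap L=L$, by $\mu X.L_1\sqcap\mu X.L_2=\mu X.(L_1\sqcap L_2)$, and by $p\&\{l.L_l\}_{l\in I}\sqcap p\&\{l.L'_l\}_{l\in J}=p\&\{l.L''_l\}_{l\in I\cup J}$, where $L''_l$ is $L_l\sqcap L'_l$ for $l\in I\cap J$, $L_l$ for $l\in I\setminus J$, and $L'_l$ for $l\in J\setminus I$. **Actions** are $\ell ::= pq!\tau\mid pq?\tau\mid pq\oplus l\mid pq\& l\mid p\rhd c$, with subjects $p,q,p,q,p$ respectively. **Global transitions** are generated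 as follows. * $p\to q:\langle\tau\rhd c\rangle.G\xrightarrow{pq!\tau}p\rightsquigarrow q:\langle\tau\rhd c\rangle.G\xrightarrow{pq?\tau}q\leadsto(\tau\rhd c).G\xrightarrow{q\rhd c}G$. * For $j\in I$: $p\to q:\{l.G_l\}_{l\in I}\xrightarrow{pq\oplus j}p\rightsquigarrow q:j\{l.G_l\}_{l\in I}\xrightarrow{pq\& j}G_j$. * $\mu X.G\xrightarrow{\ell}G'$ if $G[\mu X.G/X]\xrightarrow{\ell}G'$. * If $G\xrightarrow{\ell}G'$, then $\ell$ leads from a prefix form with continuation $G$ to the same form with continuation $G'$, provided that the subject of $\ell$ is not $p$ or $q$ under $p\to q:\langle\tau\rhd c\rangle$, is not $q$ under $p\rightsquigarrow q:\langle\tau\rhd c\rangle$, and is not $p$ under $p\leadsto(\tau\rhd c)$. * If $G_l\xrightarrow{\ell}G'_l$ for every $l\in I$ and the subject of $\ell$ is not $p$ or $q$, then $p\to q:\{l.G_l\}_{l\in I}\xrightarrow{\ell}p\to q:\{l.G'_l\}_{l\in I}$. * If $G_j\xrightarrow{\ell}G'_j$, the subject of $\ell$ is not $q$, and $G'_l=G_l$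 for $l\ne j$, then $p\rightsquigarrow q:j\{l.G_l\}_{l\in I}\xrightarrow{\ell}p\rightsquigarrow q:j\{l.G'_l\}_{l\in I}$. **Local transitions.** A configuration $(C;Q)$ over $R$ consists of a local type $C(p)$ for each $p\in R$ and a FIFO queue $Q(pq)$ of payload types and labels for each pair $p,q\in R$. The transitions, in which everything not mentioned is unchanged, are the following. * If $C(p)=q!\tau.L$, then under $pq!\tau$ the value $\tau$ is enqueued in $Q(pq)$ and $C(p)$ becomes $L$. * If $C(p)=q?\tau\rhd c.L$ and $\tau$ is at the front of $Q(qp)$, then under $qp?\tau$ it is dequeued and $C(p)$ becomes $(\tau\rhd c).L$. * If $C(p)=(\tau\rhd c).L$, then under $p\rhd c$ the type $C(p)$ becomes $L$. * If $C(p)=q\oplus\{l.L_l\}_{l\in I}$ and $i\in I$, then under $pq\oplus i$ the label $i$ is enqueued in $Q(pq)$ and $C(p)$ becomes $L_i$. * If $C(p)=q\&\{l.L_l\}_{l\in I}$, $i\in I$, and $i$ is at the front of $Q(qp)$, then under $qp\& i$ it is dequeued and $C(p)$ becomes $L_i$. **Theorem (Soundness and Completeness).** Let $G$ be a closed, guarded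 global type (without execution forms) whose interactions are all between distinct roles and whose choices are all non-empty, and let $R=\mathrm{roles}(G)$. Suppose that $G{\restriction}p$ is defined for every $p\in R$, and that whenever $\mu X.G'$ is a subterm of $G$, $p\in R$, and $G'{\restriction}p$ is a recursion variable, this variable is $X$ (this holds, in particular, if every bound recursion variable occurs in its scope). Let $C=[p\mapsto G{\restriction}p]_{p\in R}$. Then $G\approx(C;[pq\mapsto\epsilon]_{p,q\in R})$, that is, $G$ and this configuration with all queues empty have the same finite traces (finite sequences of actions, including the actions $p\rhd c$). -/

import Mathlib

universe u v

/-! ### Syntax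

Roles and labels are natural numbers.  The payload types and the cost expressions
range over arbitrary types `Ty` and `Cost`: the semantics only ever compares them
for equality.  Recursion variables are de Bruijn indices (types up to renaming of
bound variables), and a family of branches is indexed by a finite set of labels. -/

/-- Global types, including the run-time forms that occur only during execution. -/
inductive GType (Ty : Type u) (Cost : Type v) : Type (max u v)
  /-- `p → q : ⟨τ ⊳ c⟩. G` -/
  | msg (p q : ℕ) (τ : Ty) (c : Cost) (G : GType Ty Cost)
  /-- `p → q : {l. G l}` for `l ∈ I` -/
  | choice (p q : ℕ) (I : Finset ℕ) (G : {l // l ∈ I} → GType Ty Cost)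
  /-- `μ X. G`; the bound variable is index `0` in `G` -/
  | mu (G : GType Ty Cost)
  /-- `X` -/
  | var (n : ℕ)
  /-- `end` -/
  | done
  /-- run-time form `p ⇝ q : ⟨τ ⊳ c⟩. G`: sent by `p`, not yet received by `q` -/
  | msgSent (p q : ℕ) (τ : Ty) (c : Cost) (G : GType Ty Cost)
  /-- run-time form `p ⇝ q : j {l. G l}` for `l ∈ I`: the label `j ∈ I` was sent by `p`
  and not yet received by `q` -/
  | choiceSent (p q : ℕ) (I : Finset ℕ) (j : {l // l ∈ I}) (G : {l // l ∈ I} → GType Ty Cost)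
  /-- run-time form `p ⟿ (τ ⊳ c). G`: `p` is computing at cost `c` -/
  | eval (p : ℕ) (τ : Ty) (c : Cost) (G : GType Ty Cost)

/-- Local types, including the run-time form `(τ ⊳ c). L`. -/
inductive LType (Ty : Type u) (Cost : Type v) : Type (max u v)
  /-- `p ! τ. L` -/
  | send (p : ℕ) (τ : Ty) (L : LType Ty Cost)
  /-- `p ? τ ⊳ c. L` -/
  | recv (p : ℕ) (τ : Ty) (c : Cost) (L : LType Ty Cost)
  /-- `p ⊕ {l. L l}` for `l ∈ I` -/
  | select (p : ℕ) (I : Finset ℕ) (L : {l // l ∈ I} → LType Ty Cost)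
  /-- `p & {l. L l}` for `l ∈ I` -/
  | branch (p : ℕ) (I : Finset ℕ) (L : {l // l ∈ I} → LType Ty Cost)
  /-- `μ X. L`; the bound variable is index `0` in `L` -/
  | mu (L : LType Ty Cost)
  /-- `X` -/
  | var (n : ℕ)
  /-- `end` -/
  | done
  /-- run-time form `(τ ⊳ c). L` -/
  | eval (τ : Ty) (c : Cost) (L : LType Ty Cost)

/-- Actions: `pq!τ`, `pq?τ`, `pq⊕l`, `pq&l` (from `p` to `q` in all four cases) and
the computation action `p ⊳ c`. -/
inductive Act (Ty : Type u) (Cost : Type v) : Type (max u v)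
  | send (p q : ℕ) (τ : Ty)
  | recv (p q : ℕ) (τ : Ty)
  | select (p q : ℕ) (l : ℕ)
  | branch (p q : ℕ) (l : ℕ)
  | run (p : ℕ) (c : Cost)

/-- The subject of an action: the role that performs it. -/
def Act.subj {Ty : Type u} {Cost : Type v} : Act Ty Cost → ℕ
  | .send p _ _ => p
  | .recv _ q _ => q
  | .select p _ _ => p
  | .branch _ q _ => q
  | .run p _ => p

namespace GType

variable {Ty : Type u} {Cost : Type v}

/-- The set of roles occurring in a global type. -/
def roles : GType Ty Cost → Finset ℕ
  | msg p q _ _ G => {p, q} ∪ G.roles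
  | choice p q _ G => {p, q} ∪ Finset.univ.biUnion (fun i => (G i).roles)
  | mu G => G.roles
  | var _ => ∅
  | done => ∅
  | msgSent p q _ _ G => {p, q} ∪ G.roles
  | choiceSent p q _ _ G => {p, q} ∪ Finset.univ.biUnion (fun i => (G i).roles)
  | eval p _ _ G => {p} ∪ G.roles

/-- Increment every variable with index at least `k`. -/
def shift : ℕ → GType Ty Cost → GType Ty Cost
  | k, msg p q τ c G => msg p q τ c (G.shift k)
  | k, choice p q I G => choice p q I (fun i => (G i).shift k)
  | k, mu G => mu (G.shift (k + 1))
  | k, var n => if n < k then var n else var (n + 1)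
  | _, done => done
  | k, msgSent p q τ c G => msgSent p q τ c (G.shift k)
  | k, choiceSent p q I j G => choiceSent p q I j (fun i => (G i).shift k)
  | k, eval p τ c G => eval p τ c (G.shift k)

/-- `subst k H G`: capture-avoiding substitution of `H` for the variable `k` of `G`,
which is removed from the context. -/
def subst : ℕ → GType Ty Cost → GType Ty Cost → GType Ty Cost
  | k, H, msg p q τ c G => msg p q τ c (subst k H G)
  | k, H, choice p q I G => choice p q I (fun i => subst k H (G i))
  | k, H, mu G => mu (subst (k + 1) (H.shift 0) G)
  | k, H, var n => if n = k then H else if k < n then var (n - 1) else var n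
  | _, _, done => done
  | k, H, msgSent p q τ c G => msgSent p q τ c (subst k H G)
  | k, H, choiceSent p q I j G => choiceSent p q I j (fun i => subst k H (G i))
  | k, H, eval p τ c G => eval p τ c (subst k H G)

/-- All free variables of the type have index below `k`. -/
def ClosedBelow : ℕ → GType Ty Cost → Prop
  | k, msg _ _ _ _ G => G.ClosedBelow k
  | k, choice _ _ _ G => ∀ i, (G i).ClosedBelow k
  | k, mu G => G.ClosedBelow (k + 1)
  | k, var n => n < k
  | _, done => True
  | k, msgSent _ _ _ _ G => G.ClosedBelow k
  | k, choiceSent _ _ _ _ G => ∀ i, (G i).ClosedBelow k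
  | k, eval _ _ _ G => G.ClosedBelow k

/-- The type has no free recursion variable. -/
def Closed (G : GType Ty Cost) : Prop := G.ClosedBelow 0

/-- The type is `μ X₁. … μ Xₘ. X` (`m ≥ 0`), where `X` is its free variable `k`. -/
def IsBareVar : ℕ → GType Ty Cost → Prop
  | k, var n => n = k
  | k, mu G => G.IsBareVar (k + 1)
  | _, _ => False

/-- Guardedness: no subterm has the form `μ X. μ X₁. … μ Xₘ. X`. -/
def Guarded : GType Ty Cost → Prop
  | msg _ _ _ _ G => G.Guarded
  | choice _ _ _ G => ∀ i, (G i).Guarded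
  | mu G => ¬ G.IsBareVar 0 ∧ G.Guarded
  | var _ => True
  | done => True
  | msgSent _ _ _ _ G => G.Guarded
  | choiceSent _ _ _ _ G => ∀ i, (G i).Guarded
  | eval _ _ _ G => G.Guarded

/-- Every interaction is between two different roles, and every choice offers at least
one label. -/
def ProperInteractions : GType Ty Cost → Prop
  | msg p q _ _ G => p ≠ q ∧ G.ProperInteractions
  | choice p q I G => p ≠ q ∧ I.Nonempty ∧ ∀ i, (G i).ProperInteractions
  | mu G => G.ProperInteractions
  | var _ => True
  | done => True
  | msgSent p q _ _ G => p ≠ q ∧ G.ProperInteractions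
  | choiceSent p q _ _ G => p ≠ q ∧ ∀ i, (G i).ProperInteractions
  | eval _ _ _ G => G.ProperInteractions

/-- The transition relation of global types. -/
inductive Step : GType Ty Cost → Act Ty Cost → GType Ty Cost → Prop
  /-- sending a value -/
  | send (p q : ℕ) (τ : Ty) (c : Cost) (G : GType Ty Cost) :
      Step (msg p q τ c G) (.send p q τ) (msgSent p q τ c G)
  /-- sending a label -/
  | select (p q : ℕ) (I : Finset ℕ) (G : {l // l ∈ I} → GType Ty Cost) (j : {l // l ∈ I}) :
      Step (choice p q I G) (.select p q j) (choiceSent p q I j G)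
  /-- receiving a value, after which the receiver starts computing -/
  | recv (p q : ℕ) (τ : Ty) (c : Cost) (G : GType Ty Cost) :
      Step (msgSent p q τ c G) (.recv p q τ) (eval q τ c G)
  /-- finishing a computation -/
  | run (q : ℕ) (τ : Ty) (c : Cost) (G : GType Ty Cost) :
      Step (eval q τ c G) (.run q c) G
  /-- receiving a label -/
  | branch (p q : ℕ) (I : Finset ℕ) (j : {l // l ∈ I}) (G : {l // l ∈ I} → GType Ty Cost) :
      Step (choiceSent p q I j G) (.branch p q j) (G j)
  /-- unfolding a recursion -/
  | unfold (G : GType Ty Cost) (a : Act Ty Cost) (G' : GType Ty Cost) :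
      Step (subst 0 (mu G) G) a G' → Step (mu G) a G'
  /-- an action of a role unrelated to the message prefix -/
  | underMsg (p q : ℕ) (τ : Ty) (c : Cost) (G : GType Ty Cost) (a : Act Ty Cost)
      (G' : GType Ty Cost) :
      Step G a G' → a.subj ≠ p → a.subj ≠ q →
      Step (msg p q τ c G) a (msg p q τ c G')
  /-- an action, possible in every branch, of a role unrelated to the choice -/
  | underChoice (p q : ℕ) (I : Finset ℕ) (G : {l // l ∈ I} → GType Ty Cost)
      (a : Act Ty Cost) (G' : {l // l ∈ I} → GType Ty Cost) :
      (∀ i, Step (G i) a (G' i)) → a.subj ≠ p → a.subj ≠ q →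
      Step (choice p q I G) a (choice p q I G')
  /-- an action of a role other than the receiver of a message in transit -/
  | underMsgSent (p q : ℕ) (τ : Ty) (c : Cost) (G : GType Ty Cost) (a : Act Ty Cost)
      (G' : GType Ty Cost) :
      Step G a G' → a.subj ≠ q →
      Step (msgSent p q τ c G) a (msgSent p q τ c G')
  /-- an action of a role other than the computing one -/
  | underEval (p : ℕ) (τ : Ty) (c : Cost) (G : GType Ty Cost) (a : Act Ty Cost)
      (G' : GType Ty Cost) :
      Step G a G' → a.subj ≠ p →
      Step (eval p τ c G) a (eval p τ c G')
  /-- an action in the selected branch of a role other than the receiver of the label in transit -/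
  | underChoiceSent (p q : ℕ) (I : Finset ℕ) (j : {l // l ∈ I})
      (G : {l // l ∈ I} → GType Ty Cost) (a : Act Ty Cost)
      (G' : {l // l ∈ I} → GType Ty Cost) :
      Step (G j) a (G' j) → a.subj ≠ q → (∀ i, i ≠ j → G i = G' i) →
      Step (choiceSent p q I j G) a (choiceSent p q I j G')

end GType

namespace LType

variable {Ty : Type u} {Cost : Type v}

/-- Increment every variable with index at least `k`. -/
def shift : ℕ → LType Ty Cost → LType Ty Cost
  | k, send p τ L => send p τ (L.shift k)
  | k, recv p τ c L => recv p τ c (L.shift k)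
  | k, select p I L => select p I (fun i => (L i).shift k)
  | k, branch p I L => branch p I (fun i => (L i).shift k)
  | k, mu L => mu (L.shift (k + 1))
  | k, var n => if n < k then var n else var (n + 1)
  | _, done => done
  | k, eval τ c L => eval τ c (L.shift k)

/-- `subst k H L`: capture-avoiding substitution of `H` for the variable `k` of `L`,
which is removed from the context. -/
def subst : ℕ → LType Ty Cost → LType Ty Cost → LType Ty Cost
  | k, H, send p τ L => send p τ (subst k H L)
  | k, H, recv p τ c L => recv p τ c (subst k H L)
  | k, H, select p I L => select p I (fun i => subst k H (L i))
  | k, H, branch p I L => branch p I (fun i => subst k H (L i))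
  | k, H, mu L => mu (subst (k + 1) (H.shift 0) L)
  | k, H, var n => if n = k then H else if k < n then var (n - 1) else var n
  | _, _, done => done
  | k, H, eval τ c L => eval τ c (subst k H L)

/-- `L.Unfolds L'`: `L'` is obtained from `L` by finitely many unfoldings of recursions
at the head.  A recursive local type is identified with its unfolding in this way. -/
inductive Unfolds : LType Ty Cost → LType Ty Cost → Prop
  | refl (L : LType Ty Cost) : Unfolds L L
  | unfold (L L' : LType Ty Cost) : Unfolds (subst 0 (mu L) L) L' → Unfolds (mu L) L'

/-- `Merge L₁ L₂ L`: the partial operation `L₁ ⊓ L₂` is defined with value `L`. -/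
inductive Merge : LType Ty Cost → LType Ty Cost → LType Ty Cost → Prop
  | refl (L : LType Ty Cost) : Merge L L L
  | mu (L₁ L₂ L : LType Ty Cost) : Merge L₁ L₂ L → Merge (mu L₁) (mu L₂) (mu L)
  | branch (p : ℕ) (I J : Finset ℕ) (L₁ : {l // l ∈ I} → LType Ty Cost)
      (L₂ : {l // l ∈ J} → LType Ty Cost) (L : {l // l ∈ I ∪ J} → LType Ty Cost) :
      (∀ (k : ℕ) (hI : k ∈ I) (hJ : k ∈ J),
        Merge (L₁ ⟨k, hI⟩) (L₂ ⟨k, hJ⟩) (L ⟨k, Finset.mem_union_left J hI⟩)) →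
      (∀ (k : ℕ) (hI : k ∈ I), k ∉ J → L ⟨k, Finset.mem_union_left J hI⟩ = L₁ ⟨k, hI⟩) →
      (∀ (k : ℕ) (hJ : k ∈ J), k ∉ I → L ⟨k, Finset.mem_union_right I hJ⟩ = L₂ ⟨k, hJ⟩) →
      Merge (branch p I L₁) (branch p J L₂) (branch p (I ∪ J) L)

/-- `MergeList [L₁, …, Lₙ] L`: the merge `L₁ ⊓ (L₂ ⊓ (… ⊓ Lₙ))` is defined with value `L`
(`n ≥ 1`). -/
inductive MergeList : List (LType Ty Cost) → LType Ty Cost → Prop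
  | singleton (L : LType Ty Cost) : MergeList [L] L
  | cons (L₁ : LType Ty Cost) (Ls : List (LType Ty Cost)) (L₂ L : LType Ty Cost) :
      MergeList Ls L₂ → Merge L₁ L₂ L → MergeList (L₁ :: Ls) L

/-- The merge of a family of local types, taken in increasing order of the labels (the
operation is commutative and associative). -/
def MergeAll (I : Finset ℕ) (Ls : {l // l ∈ I} → LType Ty Cost) (L : LType Ty Cost) : Prop :=
  MergeList (((Finset.univ : Finset {l // l ∈ I}).sort (· ≤ ·)).map Ls) L

end LType

/-- `Proj p G L`: the projection of `G` onto `p` is defined with value `L`.  It is defined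
only on global types without run-time forms. -/
inductive Proj {Ty : Type u} {Cost : Type v} (p : ℕ) :
    GType Ty Cost → LType Ty Cost → Prop
  | msgSender (r : ℕ) (τ : Ty) (c : Cost) (G : GType Ty Cost) (L : LType Ty Cost) :
      p ≠ r → Proj p G L → Proj p (.msg p r τ c G) (.send r τ L)
  | msgReceiver (q : ℕ) (τ : Ty) (c : Cost) (G : GType Ty Cost) (L : LType Ty Cost) :
      p ≠ q → Proj p G L → Proj p (.msg q p τ c G) (.recv q τ c L)
  | msgOther (q r : ℕ) (τ : Ty) (c : Cost) (G : GType Ty Cost) (L : LType Ty Cost) :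
      ¬ (p = q ∧ q ≠ r) → ¬ (p = r ∧ r ≠ q) → Proj p G L → Proj p (.msg q r τ c G) L
  | choiceSender (r : ℕ) (I : Finset ℕ) (G : {l // l ∈ I} → GType Ty Cost)
      (L : {l // l ∈ I} → LType Ty Cost) :
      p ≠ r → (∀ i, Proj p (G i) (L i)) → Proj p (.choice p r I G) (.select r I L)
  | choiceReceiver (q : ℕ) (I : Finset ℕ) (G : {l // l ∈ I} → GType Ty Cost)
      (L : {l // l ∈ I} → LType Ty Cost) :
      p ≠ q → (∀ i, Proj p (G i) (L i)) → Proj p (.choice q p I G) (.branch q I L)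
  | choiceOther (q r : ℕ) (I : Finset ℕ) (G : {l // l ∈ I} → GType Ty Cost)
      (Ls : {l // l ∈ I} → LType Ty Cost) (L : LType Ty Cost) :
      ¬ (p = q ∧ q ≠ r) → ¬ (p = r ∧ r ≠ q) → (∀ i, Proj p (G i) (Ls i)) →
      LType.MergeAll I Ls L → Proj p (.choice q r I G) L
  | mu (G : GType Ty Cost) (L : LType Ty Cost) :
      Proj p G L → (∀ n, L ≠ .var n) → Proj p (.mu G) (.mu L)
  | muVar (G : GType Ty Cost) (n : ℕ) :
      Proj p G (.var n) → Proj p (.mu G) .done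
  | var (n : ℕ) : Proj p (.var n) (.var n)
  | done : Proj p .done .done

/-- For every subterm `μ X. G'` of the given global type: if `G'` projects onto `p` to a
recursion variable, then this variable is `X`.  (It can only fail for a subterm `μ X. G'`
in which `X` does not occur and which has a free variable bound further out.) -/
def GType.NoForeignVar {Ty : Type u} {Cost : Type v} (p : ℕ) : GType Ty Cost → Prop
  | .msg _ _ _ _ G => G.NoForeignVar p
  | .choice _ _ _ G => ∀ i, (G i).NoForeignVar p
  | .mu G => (∀ n, Proj p G (.var n) → n = 0) ∧ G.NoForeignVar p
  | .var _ => True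
  | .done => True
  | .msgSent _ _ _ _ G => G.NoForeignVar p
  | .choiceSent _ _ _ _ G => ∀ i, (G i).NoForeignVar p
  | .eval _ _ _ G => G.NoForeignVar p

/-! ### Configurations of local types -/

/-- The content of a queue: payload types and labels. -/
inductive Msg (Ty : Type u) : Type u
  | val (τ : Ty)
  | lab (l : ℕ)

/-- A configuration over a finite set `R` of roles: a local type for every role and a FIFO
queue for every pair (sender, receiver).  Messages enter a queue at the left end and leave
it at the right end. -/
structure Config (Ty : Type u) (Cost : Type v) (R : Finset ℕ) : Type (max u v) where
  types : {p // p ∈ R} → LType Ty Cost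
  queues : {p // p ∈ R} × {p // p ∈ R} → List (Msg Ty)

/-- The transition relation of configurations. -/
inductive Config.Step {Ty : Type u} {Cost : Type v} {R : Finset ℕ} :
    Config Ty Cost R → Act Ty Cost → Config Ty Cost R → Prop
  /-- sending a value: it is enqueued -/
  | send (C : {p // p ∈ R} → LType Ty Cost) (Q : {p // p ∈ R} × {p // p ∈ R} → List (Msg Ty))
      (p q : {p // p ∈ R}) (τ : Ty) (L : LType Ty Cost) :
      (C p).Unfolds (.send q τ L) →
      Config.Step ⟨C, Q⟩ (.send p q τ)
        ⟨Function.update C p L, Function.update Q (p, q) (.val τ :: Q (p, q))⟩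
  /-- receiving a value: it is dequeued -/
  | recv (C : {p // p ∈ R} → LType Ty Cost) (Q : {p // p ∈ R} × {p // p ∈ R} → List (Msg Ty))
      (p q : {p // p ∈ R}) (τ : Ty) (c : Cost) (L : LType Ty Cost) (w : List (Msg Ty)) :
      (C p).Unfolds (.recv q τ c L) → Q (q, p) = w ++ [.val τ] →
      Config.Step ⟨C, Q⟩ (.recv q p τ)
        ⟨Function.update C p (.eval τ c L), Function.update Q (q, p) w⟩
  /-- finishing a computation -/
  | run (C : {p // p ∈ R} → LType Ty Cost) (Q : {p // p ∈ R} × {p // p ∈ R} → List (Msg Ty))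
      (p : {p // p ∈ R}) (τ : Ty) (c : Cost) (L : LType Ty Cost) :
      (C p).Unfolds (.eval τ c L) →
      Config.Step ⟨C, Q⟩ (.run p c) ⟨Function.update C p L, Q⟩
  /-- sending a label: it is enqueued -/
  | select (C : {p // p ∈ R} → LType Ty Cost)
      (Q : {p // p ∈ R} × {p // p ∈ R} → List (Msg Ty))
      (p q : {p // p ∈ R}) (I : Finset ℕ) (L : {l // l ∈ I} → LType Ty Cost)
      (i : {l // l ∈ I}) :
      (C p).Unfolds (.select q I L) →
      Config.Step ⟨C, Q⟩ (.select p q i)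
        ⟨Function.update C p (L i), Function.update Q (p, q) (.lab i :: Q (p, q))⟩
  /-- receiving a label: it is dequeued -/
  | branch (C : {p // p ∈ R} → LType Ty Cost)
      (Q : {p // p ∈ R} × {p // p ∈ R} → List (Msg Ty))
      (p q : {p // p ∈ R}) (I : Finset ℕ) (L : {l // l ∈ I} → LType Ty Cost)
      (i : {l // l ∈ I}) (w : List (Msg Ty)) :
      (C p).Unfolds (.branch q I L) → Q (q, p) = w ++ [.lab i] →
      Config.Step ⟨C, Q⟩ (.branch q p i)
        ⟨Function.update C p (L i), Function.update Q (q, p) w⟩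

/-! ### Traces -/

/-- `Run step s t s'`: the state `s` evolves to `s'` by performing the sequence `t`. -/
inductive Run {S : Type u} {A : Type v} (step : S → A → S → Prop) : S → List A → S → Prop
  | nil (s : S) : Run step s [] s
  | cons (s : S) (a : A) (s' : S) (t : List A) (s'' : S) :
      step s a s' → Run step s' t s'' → Run step s (a :: t) s''

/-- The set of finite traces of a state of a labelled transition system. -/
def traces {S : Type u} {A : Type v} (step : S → A → S → Prop) (s : S) : Set (List A) :=
  {t | ∃ s', Run step s t s'}

/-- Trace equivalence `G ≈ ⟨C, Q⟩`: the two have the same finite traces. -/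
def TraceEquiv {Ty : Type u} {Cost : Type v} {R : Finset ℕ}
    (G : GType Ty Cost) (K : Config Ty Cost R) : Prop :=
  traces GType.Step G = traces Config.Step K

/-! The relation `Config.Realizes` between configurations and run-time global types is a
bisimulation containing the initial pair, whence trace equivalence. It asks separately of each role
that its local type carry out its part of the global type (`GType.Implements`), and of each ordered
pair of roles that the queue hold exactly the messages recorded as in transit, the outermost one at
the front (`GType.QueueOf`). Projection itself is no invariant: it is undefined on run-time forms,
and after a selection a role that has not learned the label still holds the merge of all branches.
Equality with the projection is therefore weakened to refinement, which allows extra branches at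
external choices. A merge refines each of its arguments, and refinement is compatible with
substitution, hence with unfolding.

An action changes only the local type of its subject and at most one queue, and it determines both
results (`LType.Acts.unique`, `Act.OnQueue.unique`). Each direction thus reduces to the existence of
a matching step. From global to local this is an induction on the derivation (`Step.exists_acts`,
`Step.exists_onQueue`); determinism reconciles the branches of a choice that perform the action
simultaneously.

From local to global (`exists_step_of_acts`) one descends to the first interaction of the acting
role. Unfolding recursions on the way enlarges the type, but `firstDepth` still drops: if the body
of `μ X` does not project to a variable, then `X` cannot be reached before the role interacts, so
substituting for `X` does not increase the depth. If the body projects to `X`, the projection is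
`end` and the role cannot act. The hypothesis on foreign variables makes these the only two cases,
and makes projection commute with unfolding. -/

/-! ### Refinement of local types -/

namespace LType

variable {Ty : Type u} {Cost : Type v}

/-- `Refines L M`: `L` is obtained from `M` by adding branches at external choices. -/
inductive Refines : LType Ty Cost → LType Ty Cost → Prop
  | send (p : ℕ) (τ : Ty) (L M : LType Ty Cost) :
      Refines L M → Refines (.send p τ L) (.send p τ M)
  | recv (p : ℕ) (τ : Ty) (c : Cost) (L M : LType Ty Cost) :
      Refines L M → Refines (.recv p τ c L) (.recv p τ c M)
  | select (p : ℕ) (I : Finset ℕ) (L M : {l // l ∈ I} → LType Ty Cost) :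
      (∀ i, Refines (L i) (M i)) → Refines (.select p I L) (.select p I M)
  | branch (p : ℕ) (I J : Finset ℕ) (L : {l // l ∈ J} → LType Ty Cost)
      (M : {l // l ∈ I} → LType Ty Cost) (h : I ⊆ J) :
      (∀ i : {l // l ∈ I}, Refines (L ⟨i.1, h i.2⟩) (M i)) →
      Refines (.branch p J L) (.branch p I M)
  | mu (L M : LType Ty Cost) : Refines L M → Refines (.mu L) (.mu M)
  | var (n : ℕ) : Refines (.var n) (.var n)
  | done : Refines .done .done
  | eval (τ : Ty) (c : Cost) (L M : LType Ty Cost) :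
      Refines L M → Refines (.eval τ c L) (.eval τ c M)

namespace Refines

theorem rfl : ∀ L : LType Ty Cost, Refines L L
  | .send _ _ L => .send _ _ _ _ (rfl L)
  | .recv _ _ _ L => .recv _ _ _ _ _ (rfl L)
  | .select _ _ L => .select _ _ _ _ fun i => rfl (L i)
  | .branch _ _ L => .branch _ _ _ _ _ (Finset.Subset.refl _) fun i => rfl (L i)
  | .mu L => .mu _ _ (rfl L)
  | .var _ => .var _
  | .done => .done
  | .eval _ _ L => .eval _ _ _ _ (rfl L)

theorem trans {L M N : LType Ty Cost} (h₁ : Refines L M) (h₂ : Refines M N) : Refines L N := by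
  induction h₁ generalizing N with
  | send p τ L M _ ih => cases h₂ with | send _ _ _ _ h => exact .send _ _ _ _ (ih h)
  | recv p τ c L M _ ih => cases h₂ with | recv _ _ _ _ _ h => exact .recv _ _ _ _ _ (ih h)
  | select p I L M _ ih =>
    cases h₂ with | select _ _ _ _ h => exact .select _ _ _ _ fun i => ih i (h i)
  | branch p I J L M hIJ _ ih =>
    cases h₂ with
    | branch _ K _ _ _ hK h =>
      exact .branch _ _ _ _ _ (hK.trans hIJ) fun i => ih ⟨i.1, hK i.2⟩ (h i)
  | mu L M _ ih => cases h₂ with | mu _ _ h => exact .mu _ _ (ih h)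
  | var n => exact h₂
  | done => exact h₂
  | eval τ c L M _ ih => cases h₂ with | eval _ _ _ _ h => exact .eval _ _ _ _ (ih h)

theorem shift {L M : LType Ty Cost} (h : Refines L M) (k : ℕ) :
    Refines (L.shift k) (M.shift k) := by
  induction h generalizing k with
  | send p τ L M _ ih => exact .send _ _ _ _ (ih k)
  | recv p τ c L M _ ih => exact .recv _ _ _ _ _ (ih k)
  | select p I L M _ ih => exact .select _ _ _ _ fun i => ih i k
  | branch p I J L M hIJ _ ih => exact .branch _ _ _ _ _ hIJ fun i => ih i k
  | mu L M _ ih => exact .mu _ _ (ih (k + 1))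
  | var n => exact rfl _
  | done => exact .done
  | eval τ c L M _ ih => exact .eval _ _ _ _ (ih k)

theorem subst {L M : LType Ty Cost} (h : Refines L M) (k : ℕ) {H K : LType Ty Cost}
    (hHK : Refines H K) : Refines (LType.subst k H L) (LType.subst k K M) := by
  induction h generalizing k H K with
  | send p τ L M _ ih => exact .send _ _ _ _ (ih k hHK)
  | recv p τ c L M _ ih => exact .recv _ _ _ _ _ (ih k hHK)
  | select p I L M _ ih => exact .select _ _ _ _ fun i => ih i k hHK
  | branch p I J L M hIJ _ ih => exact .branch _ _ _ _ _ hIJ fun i => ih i k hHK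
  | mu L M _ ih => exact .mu _ _ (ih (k + 1) (hHK.shift 0))
  | var n =>
    simp only [LType.subst]
    split_ifs
    · exact hHK
    · exact .var _
    · exact .var _
  | done => exact .done
  | eval τ c L M _ ih => exact .eval _ _ _ _ (ih k hHK)

end Refines

/-- The only property of merging that the proof uses: labels of one side are all kept, and labels
foreign to it are merely added. -/
theorem Merge.refines {L₁ L₂ L : LType Ty Cost} (h : Merge L₁ L₂ L) :
    Refines L L₁ ∧ Refines L L₂ := by
  induction h with
  | refl L => exact ⟨.rfl L, .rfl L⟩
  | mu L₁ L₂ L _ ih => exact ⟨.mu _ _ ih.1, .mu _ _ ih.2⟩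
  | branch p I J L₁ L₂ L _ h₁ h₂ ih =>
    refine ⟨.branch _ _ _ _ _ Finset.subset_union_left fun i => ?_,
      .branch _ _ _ _ _ Finset.subset_union_right fun i => ?_⟩
    · by_cases hJ : i.1 ∈ J
      · exact (ih i.1 i.2 hJ).1
      · rw [h₁ i.1 i.2 hJ]; exact .rfl _
    · by_cases hI : i.1 ∈ I
      · exact (ih i.1 hI i.2).2
      · rw [h₂ i.1 i.2 hI]; exact .rfl _

theorem MergeList.refines {Ls : List (LType Ty Cost)} {L : LType Ty Cost}
    (h : MergeList Ls L) : ∀ M ∈ Ls, Refines L M := by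
  induction h with
  | singleton L => intro M hM; rw [List.mem_singleton.1 hM]; exact .rfl _
  | cons L₁ Ls L₂ L _ hm ih =>
    intro M hM
    rcases List.mem_cons.1 hM with rfl | hM
    · exact hm.refines.1
    · exact hm.refines.2.trans (ih M hM)

theorem MergeAll.refines {I : Finset ℕ} {Ls : {l // l ∈ I} → LType Ty Cost}
    {L : LType Ty Cost} (h : MergeAll I Ls L) (i : {l // l ∈ I}) : Refines L (Ls i) :=
  MergeList.refines h _ (List.mem_map_of_mem (by simp))

theorem shift_ne_var {L : LType Ty Cost} (h : ∀ n, L ≠ .var n) (k n : ℕ) :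
    L.shift k ≠ .var n := by
  cases L <;> simp_all [shift]

theorem subst_ne_var {L : LType Ty Cost} (h : ∀ n, L ≠ .var n) (k : ℕ) (H : LType Ty Cost)
    (n : ℕ) : subst k H L ≠ .var n := by
  cases L <;> simp_all [subst]

/-! ### Head unfolding and the actions of a single local type -/

/-- The head of the type is not a recursion. -/
def NotMu : LType Ty Cost → Prop
  | mu _ => False
  | _ => True

theorem Unfolds.trans {L M N : LType Ty Cost} (h₁ : L.Unfolds M) (h₂ : M.Unfolds N) :
    L.Unfolds N := by
  induction h₁ with
  | refl => exact h₂
  | unfold L L' _ ih => exact .unfold _ _ (ih h₂)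

/-- Head unfolding is a deterministic process that stops at the first type that is not a recursion.
-/
theorem Unfolds.unique {L M N : LType Ty Cost} (h₁ : L.Unfolds M) (h₂ : L.Unfolds N)
    (hM : M.NotMu) (hN : N.NotMu) : M = N := by
  induction h₁ with
  | refl L =>
    cases h₂ with
    | refl => rfl
    | unfold L _ _ => exact hM.elim
  | unfold L L' _ ih =>
    cases h₂ with
    | refl => exact hN.elim
    | unfold _ _ h => exact ih h hM

/-- `Acts r L a L'`: the local type `L` of the role `r` performs the action `a` and
becomes `L'`, disregarding the queues. -/
inductive Acts (r : ℕ) (L : LType Ty Cost) : Act Ty Cost → LType Ty Cost → Prop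
  | send (q : ℕ) (τ : Ty) (L' : LType Ty Cost) :
      L.Unfolds (.send q τ L') → Acts r L (.send r q τ) L'
  | recv (q : ℕ) (τ : Ty) (c : Cost) (L' : LType Ty Cost) :
      L.Unfolds (.recv q τ c L') → Acts r L (.recv q r τ) (.eval τ c L')
  | run (τ : Ty) (c : Cost) (L' : LType Ty Cost) :
      L.Unfolds (.eval τ c L') → Acts r L (.run r c) L'
  | select (q : ℕ) (I : Finset ℕ) (L' : {l // l ∈ I} → LType Ty Cost) (i : {l // l ∈ I}) :
      L.Unfolds (.select q I L') → Acts r L (.select r q i) (L' i)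
  | branch (q : ℕ) (I : Finset ℕ) (L' : {l // l ∈ I} → LType Ty Cost) (i : {l // l ∈ I}) :
      L.Unfolds (.branch q I L') → Acts r L (.branch q r i) (L' i)

theorem Acts.subj {r : ℕ} {L L' : LType Ty Cost} {a : Act Ty Cost} (h : Acts r L a L') :
    a.subj = r := by
  cases h <;> rfl

/-- The head of the unfolded type is unique, and the action carries the label, so the continuation
is determined. This identifies a local successor with the one predicted by a global step. -/
theorem Acts.unique {r : ℕ} {L L₁ L₂ : LType Ty Cost} {a : Act Ty Cost}
    (h₁ : Acts r L a L₁) (h₂ : Acts r L a L₂) : L₁ = L₂ := by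
  cases h₁ with
  | send q τ _ u₁ =>
    cases h₂ with | send _ _ _ u₂ => cases u₁.unique u₂ trivial trivial; rfl
  | recv q τ c _ u₁ =>
    cases h₂ with | recv _ _ _ _ u₂ => cases u₁.unique u₂ trivial trivial; rfl
  | run τ c _ u₁ =>
    cases h₂ with | run _ _ _ u₂ => cases u₁.unique u₂ trivial trivial; rfl
  | select q I M i u₁ =>
    generalize hx : i.1 = x at h₂
    cases h₂ with
    | select _ J N j u₂ =>
      cases u₁.unique u₂ trivial trivial
      rw [Subtype.ext hx]
  | branch q I M i u₁ =>
    generalize hx : i.1 = x at h₂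
    cases h₂ with
    | branch _ J N j u₂ =>
      cases u₁.unique u₂ trivial trivial
      rw [Subtype.ext hx]

end LType

/-! ### Relaxed projection and its stability under substitution -/

/-- Projection of global types without run-time forms in which the merge of a family of
local types is relaxed to an arbitrary common refinement, and in which the body of a
recursion projects to no variable other than the bound one. -/
inductive StaticProj {Ty : Type u} {Cost : Type v} (r : ℕ) :
    GType Ty Cost → LType Ty Cost → Prop
  | msgSender (q : ℕ) (τ : Ty) (c : Cost) (G : GType Ty Cost) (L : LType Ty Cost) :
      StaticProj r G L → StaticProj r (.msg r q τ c G) (.send q τ L)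
  | msgReceiver (p : ℕ) (τ : Ty) (c : Cost) (G : GType Ty Cost) (L : LType Ty Cost) :
      r ≠ p → StaticProj r G L → StaticProj r (.msg p r τ c G) (.recv p τ c L)
  | msgOther (p q : ℕ) (τ : Ty) (c : Cost) (G : GType Ty Cost) (L : LType Ty Cost) :
      r ≠ p → r ≠ q → StaticProj r G L → StaticProj r (.msg p q τ c G) L
  | choiceSender (q : ℕ) (I : Finset ℕ) (G : {l // l ∈ I} → GType Ty Cost)
      (L : {l // l ∈ I} → LType Ty Cost) :
      (∀ i, StaticProj r (G i) (L i)) → StaticProj r (.choice r q I G) (.select q I L)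
  | choiceReceiver (p : ℕ) (I : Finset ℕ) (G : {l // l ∈ I} → GType Ty Cost)
      (L : {l // l ∈ I} → LType Ty Cost) :
      r ≠ p → (∀ i, StaticProj r (G i) (L i)) →
      StaticProj r (.choice p r I G) (.branch p I L)
  | choiceOther (p q : ℕ) (I : Finset ℕ) (G : {l // l ∈ I} → GType Ty Cost)
      (Ls : {l // l ∈ I} → LType Ty Cost) (L : LType Ty Cost) :
      r ≠ p → r ≠ q → (∀ i, StaticProj r (G i) (Ls i)) → (∀ i, L.Refines (Ls i)) →
      StaticProj r (.choice p q I G) L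
  | mu (G : GType Ty Cost) (L : LType Ty Cost) :
      StaticProj r G L → (∀ n, L ≠ .var n) → StaticProj r (.mu G) (.mu L)
  | muVar (G : GType Ty Cost) : StaticProj r G (.var 0) → StaticProj r (.mu G) .done
  | var (n : ℕ) : StaticProj r (.var n) (.var n)
  | done : StaticProj r .done .done

section StaticProj

variable {Ty : Type u} {Cost : Type v} {r : ℕ}

theorem Proj.staticProj {G : GType Ty Cost} {L : LType Ty Cost} (h : Proj r G L)
    (hG : G.ProperInteractions) (hv : G.NoForeignVar r) : StaticProj r G L := by
  induction h with
  | msgSender q τ c G L _ _ ih => exact .msgSender _ _ _ _ _ (ih hG.2 hv)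
  | msgReceiver q τ c G L hne _ ih => exact .msgReceiver _ _ _ _ _ hne (ih hG.2 hv)
  | msgOther p q τ c G L h₁ h₂ _ ih =>
    exact .msgOther _ _ _ _ _ _ (fun h => h₁ ⟨h, hG.1⟩) (fun h => h₂ ⟨h, hG.1.symm⟩)
      (ih hG.2 hv)
  | choiceSender q I G L _ _ ih => exact .choiceSender _ _ _ _ fun i => ih i (hG.2.2 i) (hv i)
  | choiceReceiver q I G L hne _ ih =>
    exact .choiceReceiver _ _ _ _ hne fun i => ih i (hG.2.2 i) (hv i)
  | choiceOther p q I G Ls L h₁ h₂ _ hm ih =>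
    exact .choiceOther _ _ _ _ Ls _ (fun h => h₁ ⟨h, hG.1⟩) (fun h => h₂ ⟨h, hG.1.symm⟩)
      (fun i => ih i (hG.2.2 i) (hv i)) hm.refines
  | mu G L _ hne ih => exact .mu _ _ (ih hG hv.2) hne
  | muVar G n hp ih =>
    obtain rfl := hv.1 n hp
    exact .muVar _ (ih hG hv.2)
  | var n => exact .var n
  | done => exact .done

theorem StaticProj.shift {G : GType Ty Cost} {L : LType Ty Cost} (h : StaticProj r G L)
    (k : ℕ) : StaticProj r (G.shift k) (L.shift k) := by
  induction h generalizing k with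
  | msgSender q τ c G L _ ih => exact .msgSender _ _ _ _ _ (ih k)
  | msgReceiver q τ c G L hne _ ih => exact .msgReceiver _ _ _ _ _ hne (ih k)
  | msgOther p q τ c G L h₁ h₂ _ ih => exact .msgOther _ _ _ _ _ _ h₁ h₂ (ih k)
  | choiceSender q I G L _ ih => exact .choiceSender _ _ _ _ fun i => ih i k
  | choiceReceiver q I G L hne _ ih => exact .choiceReceiver _ _ _ _ hne fun i => ih i k
  | choiceOther p q I G Ls L h₁ h₂ _ hm ih =>
    exact .choiceOther _ _ _ _ _ _ h₁ h₂ (fun i => ih i k) fun i => (hm i).shift k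
  | mu G L _ hne ih => exact .mu _ _ (ih (k + 1)) (LType.shift_ne_var hne _)
  | muVar G _ ih =>
    refine .muVar _ ?_
    have := ih (k + 1)
    simpa [LType.shift] using this
  | var n =>
    simp only [GType.shift, LType.shift]
    split_ifs <;> exact .var _
  | done => exact .done

/-- The delicate case is a recursion erased to `end`. Its body projects to the bound variable, which
the substitution does not touch, so the erasure persists. Had the body projected to an outer
variable, the erasure would have lost the substituted type. -/
theorem StaticProj.subst {G H : GType Ty Cost} {L N : LType Ty Cost} (h : StaticProj r G L)
    (k : ℕ) (hH : StaticProj r H N) (hN : ∀ n, N ≠ .var n) :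
    StaticProj r (.subst k H G) (.subst k N L) := by
  induction h generalizing k H N with
  | msgSender q τ c G L _ ih => exact .msgSender _ _ _ _ _ (ih k hH hN)
  | msgReceiver q τ c G L hne _ ih => exact .msgReceiver _ _ _ _ _ hne (ih k hH hN)
  | msgOther p q τ c G L h₁ h₂ _ ih => exact .msgOther _ _ _ _ _ _ h₁ h₂ (ih k hH hN)
  | choiceSender q I G L _ ih => exact .choiceSender _ _ _ _ fun i => ih i k hH hN
  | choiceReceiver q I G L hne _ ih =>
    exact .choiceReceiver _ _ _ _ hne fun i => ih i k hH hN
  | choiceOther p q I G Ls L h₁ h₂ _ hm ih =>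
    exact .choiceOther _ _ _ _ _ _ h₁ h₂ (fun i => ih i k hH hN)
      fun i => (hm i).subst k (.rfl N)
  | mu G L _ hne ih =>
    exact .mu _ _ (ih (k + 1) (hH.shift 0) (LType.shift_ne_var hN 0))
      (LType.subst_ne_var hne _ _)
  | muVar G _ ih =>
    refine .muVar _ ?_
    have := ih (k + 1) (hH.shift 0) (LType.shift_ne_var hN 0)
    simpa [LType.subst] using this
  | var n =>
    simp only [GType.subst, LType.subst]
    split_ifs
    · exact hH
    · exact .var _
    · exact .var _
  | done => exact .done

end StaticProj

/-! ### Depth of the first interaction, and well-formedness -/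

namespace GType

variable {Ty : Type u} {Cost : Type v}

/-- The number of constructors above the first interaction of `r`. -/
def firstDepth (r : ℕ) : GType Ty Cost → ℕ
  | msg p q _ _ G => if r = p ∨ r = q then 0 else G.firstDepth r + 1
  | choice p q _ G =>
      if r = p ∨ r = q then 0 else (Finset.univ.sup fun i => (G i).firstDepth r) + 1
  | mu G => G.firstDepth r + 1
  | var _ => 0
  | done => 0
  | msgSent _ q _ _ G => if r = q then 0 else G.firstDepth r + 1
  | choiceSent _ q _ j G => if r = q then 0 else (G j).firstDepth r + 1
  | eval p _ _ G => if r = p then 0 else G.firstDepth r + 1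

/-- The variable `k` lies above the first interaction of `r` only if the projection is `k` itself: a
refinement of a variable is that variable, so one branch of a choice projecting to `k` would force
the whole choice to do so, and the body of a recursion projects either to no variable or to its own.
-/
theorem firstDepth_subst_le {r : ℕ} {G : GType Ty Cost} {L : LType Ty Cost}
    (h : StaticProj r G L) {k : ℕ} (hL : L ≠ .var k) (H : GType Ty Cost) :
    (subst k H G).firstDepth r ≤ G.firstDepth r := by
  induction h generalizing k H with
  | msgSender q τ c G L _ ih => simp [subst, firstDepth]
  | msgReceiver q τ c G L hne _ ih => simp [subst, firstDepth]
  | msgOther p q τ c G L h₁ h₂ _ ih => simpa [subst, firstDepth, h₁, h₂] using ih hL H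
  | choiceSender q I G L _ ih => simp [subst, firstDepth]
  | choiceReceiver q I G L hne _ ih => simp [subst, firstDepth]
  | choiceOther p q I G Ls L h₁ h₂ _ hm ih =>
    simp only [subst, firstDepth, h₁, h₂, or_self, if_false]
    refine Nat.succ_le_succ (Finset.sup_mono_fun fun i _ => ih i ?_ H)
    intro hi
    have := hm i
    rw [hi] at this
    cases this
    exact hL rfl
  | mu G L _ hne ih => exact Nat.succ_le_succ (ih (hne _) _)
  | muVar G _ ih => exact Nat.succ_le_succ (ih (k := k + 1) (by simp) _)
  | var n =>
    have hn : n ≠ k := fun h => hL (h ▸ rfl)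
    simp only [subst, hn, if_false]
    split_ifs <;> simp [firstDepth]
  | done => exact le_rfl

/-- Static well-formedness: no run-time forms, proper interactions between roles of `R`,
all free variables below `k`. -/
def StaticWF (R : Finset ℕ) : ℕ → GType Ty Cost → Prop
  | k, msg p q _ _ G => p ∈ R ∧ q ∈ R ∧ p ≠ q ∧ G.StaticWF R k
  | k, choice p q I G => p ∈ R ∧ q ∈ R ∧ p ≠ q ∧ I.Nonempty ∧ ∀ i, (G i).StaticWF R k
  | k, mu G => G.StaticWF R (k + 1)
  | k, var n => n < k
  | _, done => True
  | _, msgSent _ _ _ _ _ => False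
  | _, choiceSent _ _ _ _ _ => False
  | _, eval _ _ _ _ => False

/-- Well-formedness of global types during execution. -/
def WF (R : Finset ℕ) : GType Ty Cost → Prop
  | msg p q _ _ G => p ∈ R ∧ q ∈ R ∧ p ≠ q ∧ G.WF R
  | choice p q I G => p ∈ R ∧ q ∈ R ∧ p ≠ q ∧ I.Nonempty ∧ ∀ i, (G i).WF R
  | mu G => G.StaticWF R 1
  | var _ => False
  | done => True
  | msgSent p q _ _ G => p ∈ R ∧ q ∈ R ∧ p ≠ q ∧ G.WF R
  | choiceSent p q _ j G => p ∈ R ∧ q ∈ R ∧ p ≠ q ∧ (G j).WF R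
  | eval p _ _ G => p ∈ R ∧ G.WF R

theorem StaticWF.wf {R : Finset ℕ} : ∀ {G : GType Ty Cost}, G.StaticWF R 0 → G.WF R
  | msg _ _ _ _ _, h => ⟨h.1, h.2.1, h.2.2.1, h.2.2.2.wf⟩
  | choice _ _ _ _, h => ⟨h.1, h.2.1, h.2.2.1, h.2.2.2.1, fun i => (h.2.2.2.2 i).wf⟩
  | mu _, h => h
  | var _, h => absurd h (Nat.not_lt_zero _)
  | done, _ => trivial
  | msgSent _ _ _ _ _, h => h.elim
  | choiceSent _ _ _ _ _, h => h.elim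
  | eval _ _ _ _, h => h.elim

theorem StaticWF.shift {R : Finset ℕ} {G : GType Ty Cost} {k : ℕ} (h : G.StaticWF R k)
    (j : ℕ) : (G.shift j).StaticWF R (k + 1) := by
  induction G generalizing j k with
  | msg p q τ c G ih => exact ⟨h.1, h.2.1, h.2.2.1, ih h.2.2.2 j⟩
  | choice p q I G ih =>
    exact ⟨h.1, h.2.1, h.2.2.1, h.2.2.2.1, fun i => ih i (h.2.2.2.2 i) j⟩
  | mu G ih => exact ih (k := k + 1) h (j + 1)
  | var n =>
    simp only [StaticWF] at h
    simp only [GType.shift]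
    split_ifs <;> simp only [StaticWF] <;> omega
  | done => trivial
  | msgSent => exact h.elim
  | choiceSent => exact h.elim
  | eval => exact h.elim

theorem StaticWF.subst {R : Finset ℕ} {G H : GType Ty Cost} {j k : ℕ} (hj : j ≤ k)
    (h : G.StaticWF R (k + 1)) (hH : H.StaticWF R k) :
    (GType.subst j H G).StaticWF R k := by
  induction G generalizing j k H with
  | msg p q τ c G ih => exact ⟨h.1, h.2.1, h.2.2.1, ih hj h.2.2.2 hH⟩
  | choice p q I G ih =>
    exact ⟨h.1, h.2.1, h.2.2.1, h.2.2.2.1, fun i => ih i hj (h.2.2.2.2 i) hH⟩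
  | mu G ih => exact ih (k := k + 1) (Nat.succ_le_succ hj) h (hH.shift 0)
  | var n =>
    simp only [StaticWF] at h
    simp only [GType.subst]
    split_ifs
    · exact hH
    all_goals simp only [StaticWF]; omega
  | done => trivial
  | msgSent => exact h.elim
  | choiceSent => exact h.elim
  | eval => exact h.elim

theorem StaticWF.unfold {R : Finset ℕ} {G : GType Ty Cost} (h : G.StaticWF R 1) :
    (GType.subst 0 (mu G) G).StaticWF R 0 :=
  StaticWF.subst (k := 0) le_rfl h (show (mu G).StaticWF R 0 from h)

/-- Every run-time form mentions some role of `R`, onto which it has no projection; this is how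
run-time forms are excluded. -/
theorem staticWF_of_proj {R : Finset ℕ} {G : GType Ty Cost} {k : ℕ} (hR : G.roles ⊆ R)
    (hk : G.ClosedBelow k) (hG : G.ProperInteractions)
    (hp : ∀ p ∈ R, ∃ L, Proj p G L) : G.StaticWF R k := by
  induction G generalizing k with
  | msg p q τ c G ih =>
    simp only [roles, Finset.union_subset_iff, Finset.insert_subset_iff,
      Finset.singleton_subset_iff] at hR
    refine ⟨hR.1.1, hR.1.2, hG.1, ih hR.2 hk hG.2 fun r hr => ?_⟩
    obtain ⟨L, hL⟩ := hp r hr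
    cases hL with
    | msgSender _ _ _ _ L _ h => exact ⟨L, h⟩
    | msgReceiver _ _ _ _ L _ h => exact ⟨L, h⟩
    | msgOther _ _ _ _ _ _ _ _ h => exact ⟨L, h⟩
  | choice p q I G ih =>
    simp only [roles, Finset.union_subset_iff, Finset.insert_subset_iff,
      Finset.singleton_subset_iff, Finset.biUnion_subset] at hR
    refine ⟨hR.1.1, hR.1.2, hG.1, hG.2.1, fun i => ih i (hR.2 i (Finset.mem_univ i)) (hk i)
      (hG.2.2 i) fun r hr => ?_⟩
    obtain ⟨L, hL⟩ := hp r hr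
    cases hL with
    | choiceSender _ _ _ L _ h => exact ⟨L i, h i⟩
    | choiceReceiver _ _ _ L _ h => exact ⟨L i, h i⟩
    | choiceOther _ _ _ _ Ls _ _ _ h => exact ⟨Ls i, h i⟩
  | mu G ih =>
    refine ih (k := k + 1) hR hk hG fun r hr => ?_
    obtain ⟨L, hL⟩ := hp r hr
    cases hL with
    | mu _ L h => exact ⟨L, h⟩
    | muVar _ n h => exact ⟨_, h⟩
  | var n => exact hk
  | done => trivial
  | msgSent p q τ c G =>
    obtain ⟨L, hL⟩ := hp p (hR (by simp [roles]))
    cases hL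
  | choiceSent p q I j G =>
    obtain ⟨L, hL⟩ := hp p (hR (by simp [roles]))
    cases hL
  | eval p τ c G =>
    obtain ⟨L, hL⟩ := hp p (hR (by simp [roles]))
    cases hL

/-! ### Local types implementing a role of a run-time global type -/

/-- `Implements r L G`: the local type `L` implements the behaviour of the role `r` in the
global type `G`, which may contain run-time forms. -/
def Implements (r : ℕ) : LType Ty Cost → GType Ty Cost → Prop
  | L, msg p q τ c G =>
      (r = p → ∃ L', L.Unfolds (.send q τ L') ∧ Implements r L' G) ∧
      (r ≠ p → r = q → ∃ L', L.Unfolds (.recv p τ c L') ∧ Implements r L' G) ∧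
      (r ≠ p → r ≠ q → Implements r L G)
  | L, choice p q I G =>
      (r = p → ∃ L', L.Unfolds (.select q I L') ∧ ∀ i, Implements r (L' i) (G i)) ∧
      -- The set `J` may exceed `I`: a receiver left with a merged type still offers the labels of
      -- other branches.
      (r ≠ p → r = q → ∃ J L', L.Unfolds (.branch p J L') ∧
        ∀ i : {l // l ∈ I}, ∃ h : i.1 ∈ J, Implements r (L' ⟨i.1, h⟩) (G i)) ∧
      (r ≠ p → r ≠ q → ∀ i, Implements r L (G i))
  -- Bodies of recursions contain no run-time forms, so the comparison falls back on projection;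
  -- recursing into the unfolding would not be structural.
  | L, mu G => ∃ L' M, L.Unfolds L' ∧ StaticProj r (mu G) M ∧ L'.Refines M
  | _, var _ => False
  | L, done => L.Unfolds .done
  | L, msgSent p q τ c G =>
      (r = q → ∃ L', L.Unfolds (.recv p τ c L') ∧ Implements r L' G) ∧
      (r ≠ q → Implements r L G)
  | L, choiceSent p q _ j G =>
      (r = q → ∃ J L', L.Unfolds (.branch p J L') ∧
        ∃ h : j.1 ∈ J, Implements r (L' ⟨j.1, h⟩) (G j)) ∧
      (r ≠ q → Implements r L (G j))
  | L, eval p τ c G =>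
      (r = p → ∃ L', L.Unfolds (.eval τ c L') ∧ Implements r L' G) ∧
      (r ≠ p → Implements r L G)

theorem Implements.of_unfolds {r : ℕ} {G : GType Ty Cost} {L L₁ : LType Ty Cost}
    (hu : L.Unfolds L₁) (h : Implements r L₁ G) : Implements r L G := by
  induction G with
  | msg p q τ c G ih =>
    refine ⟨fun h₁ => ?_, fun h₁ h₂ => ?_, fun h₁ h₂ => ih (h.2.2 h₁ h₂)⟩
    · obtain ⟨L', u, hi⟩ := h.1 h₁
      exact ⟨L', hu.trans u, hi⟩
    · obtain ⟨L', u, hi⟩ := h.2.1 h₁ h₂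
      exact ⟨L', hu.trans u, hi⟩
  | choice p q I G ih =>
    refine ⟨fun h₁ => ?_, fun h₁ h₂ => ?_, fun h₁ h₂ i => ih i (h.2.2 h₁ h₂ i)⟩
    · obtain ⟨L', u, hi⟩ := h.1 h₁
      exact ⟨L', hu.trans u, hi⟩
    · obtain ⟨J, L', u, hi⟩ := h.2.1 h₁ h₂
      exact ⟨J, L', hu.trans u, hi⟩
  | mu G ih =>
    obtain ⟨L', M, u, hi⟩ := h
    exact ⟨L', M, hu.trans u, hi⟩
  | var n => exact h.elim
  | done => exact hu.trans h
  | msgSent p q τ c G ih =>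
    refine ⟨fun h₁ => ?_, fun h₁ => ih (h.2 h₁)⟩
    obtain ⟨L', u, hi⟩ := h.1 h₁
    exact ⟨L', hu.trans u, hi⟩
  | choiceSent p q I j G ih =>
    refine ⟨fun h₁ => ?_, fun h₁ => ih j (h.2 h₁)⟩
    obtain ⟨J, L', u, hi⟩ := h.1 h₁
    exact ⟨J, L', hu.trans u, hi⟩
  | eval p τ c G ih =>
    refine ⟨fun h₁ => ?_, fun h₁ => ih (h.2 h₁)⟩
    obtain ⟨L', u, hi⟩ := h.1 h₁
    exact ⟨L', hu.trans u, hi⟩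

/-- At a choice between other roles, refinements compose: a type refining the merged projection
refines the projection of each branch. -/
theorem _root_.StaticProj.implements {R : Finset ℕ} {r : ℕ} {G : GType Ty Cost}
    {L M : LType Ty Cost} (h : StaticProj r G M) (hG : G.StaticWF R 0) (hL : L.Refines M) :
    Implements r L G := by
  induction h generalizing L with
  | msgSender q τ c G M _ ih =>
    cases hL with
    | send _ _ L _ hL =>
      exact ⟨fun _ => ⟨L, .refl _, ih hG.2.2.2 hL⟩, fun h => (h rfl).elim, fun h => (h rfl).elim⟩
  | msgReceiver p τ c G M hne _ ih =>
    cases hL with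
    | recv _ _ _ L _ hL =>
      exact ⟨fun h => (hne h).elim, fun _ _ => ⟨L, .refl _, ih hG.2.2.2 hL⟩,
        fun _ h => (h rfl).elim⟩
  | msgOther p q τ c G M h₁ h₂ _ ih =>
    exact ⟨fun h => (h₁ h).elim, fun _ h => (h₂ h).elim, fun _ _ => ih hG.2.2.2 hL⟩
  | choiceSender q I G M _ ih =>
    cases hL with
    | select _ _ L _ hL =>
      exact ⟨fun _ => ⟨L, .refl _, fun i => ih i (hG.2.2.2.2 i) (hL i)⟩,
        fun h => (h rfl).elim, fun h => (h rfl).elim⟩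
  | choiceReceiver p I G M hne _ ih =>
    cases hL with
    | branch _ _ J L _ hIJ hL =>
      exact ⟨fun h => (hne h).elim,
        fun _ _ => ⟨J, L, .refl _, fun i => ⟨hIJ i.2, ih i (hG.2.2.2.2 i) (hL i)⟩⟩,
        fun _ h => (h rfl).elim⟩
  | choiceOther p q I G Ls M h₁ h₂ _ hm ih =>
    exact ⟨fun h => (h₁ h).elim, fun _ h => (h₂ h).elim,
      fun _ _ i => ih i (hG.2.2.2.2 i) (hL.trans (hm i))⟩
  | mu G M hp hne ih => exact ⟨L, _, .refl _, .mu _ _ hp hne, hL⟩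
  | muVar G hp ih => exact ⟨L, _, .refl _, .muVar _ hp, hL⟩
  | var n => exact absurd hG (Nat.not_lt_zero n)
  | done => cases hL; exact .refl _

/-- Either the local recursion is unfolded along with the global one, substitution preserving both
projection and refinement, or the local type is `end` and stays so. -/
theorem Implements.unfold {R : Finset ℕ} {r : ℕ} {G : GType Ty Cost} {L : LType Ty Cost}
    (hG : G.StaticWF R 1) (h : Implements r L (mu G)) :
    Implements r L (subst 0 (mu G) G) := by
  obtain ⟨L', M, hu, hp, hr⟩ := h
  refine .of_unfolds hu ?_
  cases hp with
  | mu _ M hp hne =>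
    cases hr with
    | mu L _ hr =>
      refine .of_unfolds (.unfold _ _ (.refl _)) ?_
      exact (hp.subst 0 (.mu _ _ hp hne) (by simp)).implements hG.unfold
        (hr.subst 0 (.mu _ _ hr))
  | muVar _ hp =>
    exact (hp.subst 0 (.muVar _ hp) (by simp)).implements hG.unfold
      (by simpa [LType.subst] using hr)

/-! ### Messages in transit -/

/-- `QueueOf s r G w`: in the global type `G`, the messages sent by `s` and not yet received
by `r` are those of the queue `w`. -/
def QueueOf (s r : ℕ) : GType Ty Cost → List (Msg Ty) → Prop
  -- A role that still has to act at this prefix is blocked below it, so it has nothing in transit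
  -- there.
  | msg p q _ _ G, w => (s = p ∨ s = q → w = []) ∧ QueueOf s r G w
  | choice p q _ G, w => (s = p ∨ s = q → w = []) ∧ ∀ i, QueueOf s r (G i) w
  | mu _, w => w = []
  | var _, w => w = []
  | done, w => w = []
  | msgSent p q τ _ G, w => (s = q → w = []) ∧
      (s = p ∧ r = q → ∃ w', w = w' ++ [.val τ] ∧ QueueOf s r G w') ∧
      (¬ (s = p ∧ r = q) → QueueOf s r G w)
  | choiceSent p q _ j G, w => (s = q → w = []) ∧
      (s = p ∧ r = q → ∃ w', w = w' ++ [.lab j] ∧ QueueOf s r (G j) w') ∧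
      (¬ (s = p ∧ r = q) → QueueOf s r (G j) w)
  | eval p _ _ G, w => (s = p → w = []) ∧ QueueOf s r G w

theorem StaticWF.queueOf_nil {R : Finset ℕ} {s r : ℕ} {G : GType Ty Cost} {k : ℕ}
    (h : G.StaticWF R k) : QueueOf s r G [] := by
  induction G generalizing k with
  | msg p q τ c G ih => exact ⟨fun _ => rfl, ih h.2.2.2⟩
  | choice p q I G ih => exact ⟨fun _ => rfl, fun i => ih i (h.2.2.2.2 i)⟩
  | mu => rfl
  | var => rfl
  | done => rfl
  | msgSent => exact h.elim
  | choiceSent => exact h.elim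
  | eval => exact h.elim

end GType

/-- `a.OnQueue s r w w'`: the action `a` changes the queue from `s` to `r` from `w` to `w'`. -/
def Act.OnQueue {Ty : Type u} {Cost : Type v} (s r : ℕ) :
    Act Ty Cost → List (Msg Ty) → List (Msg Ty) → Prop
  | .send p q τ, w, w' => if s = p ∧ r = q then w' = .val τ :: w else w' = w
  | .recv p q τ, w, w' => if s = p ∧ r = q then w = w' ++ [.val τ] else w' = w
  | .select p q l, w, w' => if s = p ∧ r = q then w' = .lab l :: w else w' = w
  | .branch p q l, w, w' => if s = p ∧ r = q then w = w' ++ [.lab l] else w' = w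
  | .run _ _, w, w' => w' = w

/-- All roles taking part in the action are in `R`. -/
def Act.RolesIn {Ty : Type u} {Cost : Type v} (R : Finset ℕ) : Act Ty Cost → Prop
  | .send p q _ => p ∈ R ∧ q ∈ R
  | .recv p q _ => p ∈ R ∧ q ∈ R
  | .select p q _ => p ∈ R ∧ q ∈ R
  | .branch p q _ => p ∈ R ∧ q ∈ R
  | .run p _ => p ∈ R

namespace Act.OnQueue

variable {Ty : Type u} {Cost : Type v} {s r : ℕ} {a : Act Ty Cost} {w w₁ w₂ : List (Msg Ty)}

theorem unique (h₁ : a.OnQueue s r w w₁) (h₂ : a.OnQueue s r w w₂) : w₁ = w₂ := by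
  cases a <;> simp only [OnQueue] at h₁ h₂
  case run => rw [h₁, h₂]
  all_goals
    split_ifs at h₁ h₂
    · simp_all
    · simp_all

/-- Only `s` can enqueue here, and nothing can be dequeued from an empty queue. -/
theorem eq_nil (h : a.OnQueue s r [] w) (ha : a.subj ≠ s) : w = [] := by
  cases a <;> simp only [OnQueue, subj] at h ha
  case run => exact h
  all_goals
    split_ifs at h with hc
    · first
      | exact (ha hc.1.symm).elim
      | simp at h
    · exact h

/-- Only the reader `r` touches the front of the queue, so an older message can be put there without
affecting the action. -/
theorem append (h : a.OnQueue s r w w₁) (ha : a.subj ≠ r) (m : Msg Ty) :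
    a.OnQueue s r (w ++ [m]) (w₁ ++ [m]) := by
  cases a <;> simp only [OnQueue, subj] at h ha ⊢
  case run => rw [h]
  all_goals
    split_ifs at h ⊢ with hc
    · first
      | exact (ha hc.2.symm).elim
      | simp [h]
    · rw [h]

end Act.OnQueue

/-! ### Global steps preserve the invariants -/

namespace GType

variable {Ty : Type u} {Cost : Type v}

namespace Step

theorem wf {R : Finset ℕ} {G G' : GType Ty Cost} {a : Act Ty Cost} (h : Step G a G')
    (hG : G.WF R) : G'.WF R ∧ a.RolesIn R := by
  induction h with
  | send => exact ⟨hG, hG.1, hG.2.1⟩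
  | select p q I G j => exact ⟨⟨hG.1, hG.2.1, hG.2.2.1, hG.2.2.2.2 j⟩, hG.1, hG.2.1⟩
  | recv => exact ⟨⟨hG.2.1, hG.2.2.2⟩, hG.1, hG.2.1⟩
  | run => exact ⟨hG.2, hG.1⟩
  | branch => exact ⟨hG.2.2.2, hG.1, hG.2.1⟩
  | unfold G a G' _ ih => exact ih (StaticWF.unfold hG).wf
  | underMsg p q τ c G a G' _ _ _ ih =>
    exact ⟨⟨hG.1, hG.2.1, hG.2.2.1, (ih hG.2.2.2).1⟩, (ih hG.2.2.2).2⟩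
  | underChoice p q I G a G' _ _ _ ih =>
    obtain ⟨i, hi⟩ := hG.2.2.2.1
    exact ⟨⟨hG.1, hG.2.1, hG.2.2.1, hG.2.2.2.1, fun i => (ih i (hG.2.2.2.2 i)).1⟩,
      (ih ⟨i, hi⟩ (hG.2.2.2.2 _)).2⟩
  | underMsgSent p q τ c G a G' _ _ ih =>
    exact ⟨⟨hG.1, hG.2.1, hG.2.2.1, (ih hG.2.2.2).1⟩, (ih hG.2.2.2).2⟩
  | underEval p τ c G a G' _ _ ih => exact ⟨⟨hG.1, (ih hG.2).1⟩, (ih hG.2).2⟩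
  | underChoiceSent p q I j G a G' _ _ _ ih =>
    exact ⟨⟨hG.1, hG.2.1, hG.2.2.1, (ih hG.2.2.2).1⟩, (ih hG.2.2.2).2⟩

/-- For a role that does not act, a step can only discard obligations: clauses about the acting role
vanish, and a selection leaves one branch out of those already implemented. -/
theorem implements_of_ne {R : Finset ℕ} {G G' : GType Ty Cost} {a : Act Ty Cost}
    (h : Step G a G') (hG : G.WF R) {r : ℕ} (hr : r ≠ a.subj) {L : LType Ty Cost}
    (hL : Implements r L G) : Implements r L G' := by
  induction h generalizing L with
  | send p q τ c G =>
    exact ⟨hL.2.1 hr, hL.2.2 hr⟩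
  | select p q I G j =>
    refine ⟨fun h => ?_, fun h => hL.2.2 hr h j⟩
    obtain ⟨J, L', u, hi⟩ := hL.2.1 hr h
    exact ⟨J, L', u, hi j⟩
  | recv p q τ c G => exact ⟨fun h => (hr h).elim, hL.2⟩
  | run q τ c G => exact hL.2 hr
  | branch p q I j G => exact hL.2 hr
  | unfold G a G' _ ih => exact ih (StaticWF.unfold hG).wf hr (hL.unfold hG)
  | underMsg p q τ c G a G' _ _ _ ih =>
    refine ⟨fun h₁ => ?_, fun h₁ h₂ => ?_, fun h₁ h₂ => ih hG.2.2.2 hr (hL.2.2 h₁ h₂)⟩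
    · obtain ⟨L', u, hi⟩ := hL.1 h₁
      exact ⟨L', u, ih hG.2.2.2 hr hi⟩
    · obtain ⟨L', u, hi⟩ := hL.2.1 h₁ h₂
      exact ⟨L', u, ih hG.2.2.2 hr hi⟩
  | underChoice p q I G a G' _ _ _ ih =>
    refine ⟨fun h₁ => ?_, fun h₁ h₂ => ?_,
      fun h₁ h₂ i => ih i (hG.2.2.2.2 i) hr (hL.2.2 h₁ h₂ i)⟩
    · obtain ⟨L', u, hi⟩ := hL.1 h₁
      exact ⟨L', u, fun i => ih i (hG.2.2.2.2 i) hr (hi i)⟩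
    · obtain ⟨J, L', u, hi⟩ := hL.2.1 h₁ h₂
      exact ⟨J, L', u, fun i => ⟨(hi i).1, ih i (hG.2.2.2.2 i) hr (hi i).2⟩⟩
  | underMsgSent p q τ c G a G' _ _ ih =>
    refine ⟨fun h₁ => ?_, fun h₁ => ih hG.2.2.2 hr (hL.2 h₁)⟩
    obtain ⟨L', u, hi⟩ := hL.1 h₁
    exact ⟨L', u, ih hG.2.2.2 hr hi⟩
  | underEval p τ c G a G' _ _ ih =>
    refine ⟨fun h₁ => ?_, fun h₁ => ih hG.2 hr (hL.2 h₁)⟩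
    obtain ⟨L', u, hi⟩ := hL.1 h₁
    exact ⟨L', u, ih hG.2 hr hi⟩
  | underChoiceSent p q I j G a G' _ _ _ ih =>
    refine ⟨fun h₁ => ?_, fun h₁ => ih hG.2.2.2 hr (hL.2 h₁)⟩
    obtain ⟨J, L', u, hJ, hi⟩ := hL.1 h₁
    exact ⟨J, L', u, hJ, ih hG.2.2.2 hr hi⟩

theorem exists_acts {R : Finset ℕ} {G G' : GType Ty Cost} {a : Act Ty Cost}
    (h : Step G a G') (hG : G.WF R) {L : LType Ty Cost} (hL : Implements a.subj L G) :
    ∃ L', LType.Acts a.subj L a L' ∧ Implements a.subj L' G' := by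
  induction h with
  | send p q τ c G =>
    obtain ⟨L', u, hi⟩ := hL.1 rfl
    exact ⟨L', .send _ _ _ u, fun h => (hG.2.2.1 h).elim, fun _ => hi⟩
  | select p q I G j =>
    obtain ⟨L', u, hi⟩ := hL.1 rfl
    exact ⟨L' j, .select _ _ _ _ u, fun h => (hG.2.2.1 h).elim, fun _ => hi j⟩
  | recv p q τ c G =>
    obtain ⟨L', u, hi⟩ := hL.1 rfl
    exact ⟨_, .recv _ _ _ _ u, fun _ => ⟨L', .refl _, hi⟩, fun h => (h rfl).elim⟩
  | run q τ c G =>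
    obtain ⟨L', u, hi⟩ := hL.1 rfl
    exact ⟨L', .run _ _ _ u, hi⟩
  | branch p q I j G =>
    obtain ⟨J, L', u, hJ, hi⟩ := hL.1 rfl
    exact ⟨L' ⟨j.1, hJ⟩, .branch _ _ _ ⟨j.1, hJ⟩ u, hi⟩
  | unfold G a G' _ ih => exact ih (StaticWF.unfold hG).wf (hL.unfold hG)
  | underMsg p q τ c G a G' _ h₁ h₂ ih =>
    obtain ⟨L', ha, hi⟩ := ih hG.2.2.2 (hL.2.2 h₁ h₂)
    exact ⟨L', ha, fun h => (h₁ h).elim, fun _ h => (h₂ h).elim, fun _ _ => hi⟩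
  | underChoice p q I G a G' _ h₁ h₂ ih =>
    choose L' ha hi using fun i => ih i (hG.2.2.2.2 i) (hL.2.2 h₁ h₂ i)
    obtain ⟨i₀, hi₀⟩ := hG.2.2.2.1
    refine ⟨L' ⟨i₀, hi₀⟩, ha _, fun h => (h₁ h).elim, fun _ h => (h₂ h).elim,
      fun _ _ i => ?_⟩
    -- Each branch yields its own successor of the same `L`; determinism makes them equal.
    rw [(ha ⟨i₀, hi₀⟩).unique (ha i)]
    exact hi i
  | underMsgSent p q τ c G a G' _ h₁ ih =>
    obtain ⟨L', ha, hi⟩ := ih hG.2.2.2 (hL.2 h₁)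
    exact ⟨L', ha, fun h => (h₁ h).elim, fun _ => hi⟩
  | underEval p τ c G a G' _ h₁ ih =>
    obtain ⟨L', ha, hi⟩ := ih hG.2 (hL.2 h₁)
    exact ⟨L', ha, fun h => (h₁ h).elim, fun _ => hi⟩
  | underChoiceSent p q I j G a G' _ h₁ _ ih =>
    obtain ⟨L', ha, hi⟩ := ih hG.2.2.2 (hL.2 h₁)
    exact ⟨L', ha, fun h => (h₁ h).elim, fun _ => hi⟩

theorem exists_onQueue {R : Finset ℕ} {G G' : GType Ty Cost} {a : Act Ty Cost}
    (h : Step G a G') (hG : G.WF R) {s r : ℕ} {w : List (Msg Ty)} (hw : QueueOf s r G w) :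
    ∃ w', a.OnQueue s r w w' ∧ QueueOf s r G' w' := by
  induction h generalizing w with
  | send p q τ c G =>
    by_cases hc : s = p ∧ r = q
    · obtain rfl := hw.1 (.inl hc.1)
      refine ⟨[.val τ], by simp [Act.OnQueue, hc], fun h => ?_, fun _ => ⟨[], rfl, hw.2⟩,
        fun h => (h hc).elim⟩
      exact (hG.2.2.1 (hc.1.symm.trans h)).elim
    · exact ⟨w, by simp [Act.OnQueue, hc], fun h => hw.1 (.inr h), fun h => (hc h).elim,
        fun _ => hw.2⟩
  | select p q I G j =>
    by_cases hc : s = p ∧ r = q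
    · obtain rfl := hw.1 (.inl hc.1)
      refine ⟨[.lab j], by simp [Act.OnQueue, hc], fun h => ?_, fun _ => ⟨[], rfl, hw.2 j⟩,
        fun h => (h hc).elim⟩
      exact (hG.2.2.1 (hc.1.symm.trans h)).elim
    · exact ⟨w, by simp [Act.OnQueue, hc], fun h => hw.1 (.inr h), fun h => (hc h).elim,
        fun _ => hw.2 j⟩
  | recv p q τ c G =>
    by_cases hc : s = p ∧ r = q
    · obtain ⟨w', rfl, hw'⟩ := hw.2.1 hc
      exact ⟨w', by simp [Act.OnQueue, hc],
        fun h => (hG.2.2.1 (hc.1.symm.trans h)).elim, hw'⟩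
    · exact ⟨w, by simp [Act.OnQueue, hc], hw.1, hw.2.2 hc⟩
  | run q τ c G => exact ⟨w, rfl, hw.2⟩
  | branch p q I j G =>
    by_cases hc : s = p ∧ r = q
    · obtain ⟨w', rfl, hw'⟩ := hw.2.1 hc
      exact ⟨w', by simp [Act.OnQueue, hc], hw'⟩
    · exact ⟨w, by simp [Act.OnQueue, hc], hw.2.2 hc⟩
  | unfold G a G' _ ih =>
    obtain rfl : w = [] := hw
    exact ih (StaticWF.unfold hG).wf (StaticWF.unfold hG).queueOf_nil
  | underMsg p q τ c G a G' _ h₁ h₂ ih =>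
    obtain ⟨w', ha, hw'⟩ := ih hG.2.2.2 hw.2
    refine ⟨w', ha, fun h => ?_, hw'⟩
    rw [hw.1 h] at ha
    exact ha.eq_nil (by rcases h with rfl | rfl <;> assumption)
  | underChoice p q I G a G' _ h₁ h₂ ih =>
    choose w' ha hw' using fun i => ih i (hG.2.2.2.2 i) (hw.2 i)
    obtain ⟨i₀, hi₀⟩ := hG.2.2.2.1
    refine ⟨w' ⟨i₀, hi₀⟩, ha _, fun h => ?_, fun i => ?_⟩
    · have ha := ha ⟨i₀, hi₀⟩
      rw [hw.1 h] at ha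
      exact ha.eq_nil (by rcases h with rfl | rfl <;> assumption)
    · rw [(ha ⟨i₀, hi₀⟩).unique (ha i)]
      exact hw' i
  | underMsgSent p q τ c G a G' _ h₁ ih =>
    by_cases hc : s = p ∧ r = q
    · obtain ⟨w₀, rfl, hw₀⟩ := hw.2.1 hc
      obtain ⟨w', ha, hw'⟩ := ih hG.2.2.2 hw₀
      exact ⟨_, ha.append (hc.2 ▸ h₁) _, fun h => (hG.2.2.1 (hc.1.symm.trans h)).elim,
        fun _ => ⟨w', rfl, hw'⟩, fun h => (h hc).elim⟩
    · obtain ⟨w', ha, hw'⟩ := ih hG.2.2.2 (hw.2.2 hc)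
      refine ⟨w', ha, fun h => ?_, fun h => (hc h).elim, fun _ => hw'⟩
      rw [hw.1 h] at ha
      exact ha.eq_nil (h ▸ h₁)
  | underEval p τ c G a G' _ h₁ ih =>
    obtain ⟨w', ha, hw'⟩ := ih hG.2 hw.2
    refine ⟨w', ha, fun h => ?_, hw'⟩
    rw [hw.1 h] at ha
    exact ha.eq_nil (h ▸ h₁)
  | underChoiceSent p q I j G a G' _ h₁ _ ih =>
    by_cases hc : s = p ∧ r = q
    · obtain ⟨w₀, rfl, hw₀⟩ := hw.2.1 hc
      obtain ⟨w', ha, hw'⟩ := ih hG.2.2.2 hw₀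
      exact ⟨_, ha.append (hc.2 ▸ h₁) _, fun h => (hG.2.2.1 (hc.1.symm.trans h)).elim,
        fun _ => ⟨w', rfl, hw'⟩, fun h => (h hc).elim⟩
    · obtain ⟨w', ha, hw'⟩ := ih hG.2.2.2 (hw.2.2 hc)
      refine ⟨w', ha, fun h => ?_, fun h => (hc h).elim, fun _ => hw'⟩
      rw [hw.1 h] at ha
      exact ha.eq_nil (h ▸ h₁)

end Step

/-! ### From local actions to global steps -/

/-- If `a` is a reception, then its message is at the front of its queue in `G`. -/
def Ready (G : GType Ty Cost) : Act Ty Cost → Prop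
  | .recv p q τ => ∃ w, QueueOf p q G (w ++ [.val τ])
  | .branch p q l => ∃ w, QueueOf p q G (w ++ [.lab l])
  | _ => True

theorem Ready.imp {G G' : GType Ty Cost} {a : Act Ty Cost}
    (ha : G.Ready a) (h : ∀ s w, QueueOf s a.subj G w → QueueOf s a.subj G' w) :
    G'.Ready a := by
  cases a with
  | recv p q τ => exact let ⟨w, hw⟩ := ha; ⟨w, h _ _ hw⟩
  | branch p q l => exact let ⟨w, hw⟩ := ha; ⟨w, h _ _ hw⟩
  | send => trivial
  | select => trivial
  | run => trivial

/-- Induction on a bound for `firstDepth`. At the first interaction of `r`, uniqueness of the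
unfolded head forces the action to be the one offered there; above it, the prefixes do not block
`r`, and `Ready` passes to the continuation. -/
theorem exists_step_of_acts {R : Finset ℕ} (n : ℕ) {r : ℕ} {G : GType Ty Cost}
    {L L' : LType Ty Cost} {a : Act Ty Cost} (hn : G.firstDepth r < n) (hG : G.WF R)
    (hL : Implements r L G) (ha : LType.Acts r L a L') (hQ : G.Ready a) :
    ∃ G', Step G a G' := by
  induction n generalizing G with
  | zero => exact absurd hn (Nat.not_lt_zero _)
  | succ n ih =>
  have hs := ha.subj
  cases G with
  | msg p q τ c G =>
    by_cases h₁ : r = p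
    · obtain ⟨M, u, -⟩ := hL.1 h₁
      subst h₁
      cases ha with
      | send _ _ _ u' => cases u.unique u' trivial trivial; exact ⟨_, .send _ _ _ _ _⟩
      | recv _ _ _ _ u' => cases u.unique u' trivial trivial
      | run _ _ _ u' => cases u.unique u' trivial trivial
      | select _ _ _ _ u' => cases u.unique u' trivial trivial
      | branch _ _ _ _ u' => cases u.unique u' trivial trivial
    by_cases h₂ : r = q
    · obtain ⟨M, u, -⟩ := hL.2.1 h₁ h₂
      subst h₂
      cases ha with
      | send _ _ _ u' => cases u.unique u' trivial trivial
      | recv _ _ _ _ u' =>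
        cases u.unique u' trivial trivial
        -- The sender has not passed this prefix, so its queue is empty and the reception is not
        -- ready.
        obtain ⟨w, hw⟩ := hQ
        simpa using hw.1 (.inl rfl)
      | run _ _ _ u' => cases u.unique u' trivial trivial
      | select _ _ _ _ u' => cases u.unique u' trivial trivial
      | branch _ _ _ _ u' => cases u.unique u' trivial trivial
    · simp only [firstDepth, h₁, h₂, or_self, if_false] at hn
      obtain ⟨G', h⟩ := ih (Nat.lt_of_succ_lt_succ hn) hG.2.2.2 (hL.2.2 h₁ h₂)
        (hQ.imp fun _ _ h => h.2)
      exact ⟨_, .underMsg _ _ _ _ _ _ _ h (hs ▸ h₁) (hs ▸ h₂)⟩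
  | choice p q I G =>
    by_cases h₁ : r = p
    · obtain ⟨M, u, -⟩ := hL.1 h₁
      subst h₁
      cases ha with
      | send _ _ _ u' => cases u.unique u' trivial trivial
      | recv _ _ _ _ u' => cases u.unique u' trivial trivial
      | run _ _ _ u' => cases u.unique u' trivial trivial
      | select _ _ _ i u' => cases u.unique u' trivial trivial; exact ⟨_, .select _ _ _ _ i⟩
      | branch _ _ _ _ u' => cases u.unique u' trivial trivial
    by_cases h₂ : r = q
    · obtain ⟨J, M, u, -⟩ := hL.2.1 h₁ h₂
      subst h₂
      cases ha with
      | send _ _ _ u' => cases u.unique u' trivial trivial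
      | recv _ _ _ _ u' => cases u.unique u' trivial trivial
      | run _ _ _ u' => cases u.unique u' trivial trivial
      | select _ _ _ _ u' => cases u.unique u' trivial trivial
      | branch _ _ _ _ u' =>
        cases u.unique u' trivial trivial
        obtain ⟨w, hw⟩ := hQ
        simpa using hw.1 (.inl rfl)
    · simp only [firstDepth, h₁, h₂, or_self, if_false] at hn
      choose G' h using fun i => ih
        ((Finset.le_sup (f := fun i => (G i).firstDepth r) (Finset.mem_univ i)).trans_lt
          (Nat.lt_of_succ_lt_succ hn))
        (hG.2.2.2.2 i) (hL.2.2 h₁ h₂ i) (hQ.imp fun _ _ h => h.2 i)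
      exact ⟨_, .underChoice _ _ _ _ _ G' h (hs ▸ h₁) (hs ▸ h₂)⟩
  | mu G =>
    have hL' := hL.unfold hG
    obtain ⟨L₁, M, u, hp, hr⟩ := hL
    cases hp with
    | mu _ M hp hne =>
      -- The body does not project to the bound variable, so its unfolding is no deeper than the
      -- body, which is one less deep than the recursion.
      obtain ⟨G', h⟩ := ih
        ((firstDepth_subst_le hp (hne 0) _).trans_lt (Nat.lt_of_succ_lt_succ hn))
        (StaticWF.unfold hG).wf hL'
        (hQ.imp fun _ w h => by
          obtain rfl : w = [] := h
          exact (StaticWF.unfold hG).queueOf_nil)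
      exact ⟨G', .unfold _ _ _ h⟩
    | muVar _ hp =>
      -- Here the local type unfolds to `end`, which admits no action.
      cases hr
      cases ha with
      | send _ _ _ u' => cases u.unique u' trivial trivial
      | recv _ _ _ _ u' => cases u.unique u' trivial trivial
      | run _ _ _ u' => cases u.unique u' trivial trivial
      | select _ _ _ _ u' => cases u.unique u' trivial trivial
      | branch _ _ _ _ u' => cases u.unique u' trivial trivial
  | var n => exact hL.elim
  | done =>
    have u : L.Unfolds .done := hL
    cases ha with
    | send _ _ _ u' => cases u.unique u' trivial trivial
    | recv _ _ _ _ u' => cases u.unique u' trivial trivial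
    | run _ _ _ u' => cases u.unique u' trivial trivial
    | select _ _ _ _ u' => cases u.unique u' trivial trivial
    | branch _ _ _ _ u' => cases u.unique u' trivial trivial
  | msgSent p q τ c G =>
    by_cases h₁ : r = q
    · obtain ⟨M, u, -⟩ := hL.1 h₁
      subst h₁
      cases ha with
      | send _ _ _ u' => cases u.unique u' trivial trivial
      | recv _ _ _ _ u' => cases u.unique u' trivial trivial; exact ⟨_, .recv _ _ _ _ _⟩
      | run _ _ _ u' => cases u.unique u' trivial trivial
      | select _ _ _ _ u' => cases u.unique u' trivial trivial
      | branch _ _ _ _ u' => cases u.unique u' trivial trivial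
    · simp only [firstDepth, h₁, if_false] at hn
      obtain ⟨G', h⟩ := ih (Nat.lt_of_succ_lt_succ hn) hG.2.2.2 (hL.2 h₁)
        (hQ.imp fun _ _ h => h.2.2 fun h => h₁ (hs ▸ h.2))
      exact ⟨_, .underMsgSent _ _ _ _ _ _ _ h (hs ▸ h₁)⟩
  | choiceSent p q I j G =>
    by_cases h₁ : r = q
    · obtain ⟨J, M, u, -⟩ := hL.1 h₁
      subst h₁
      cases ha with
      | send _ _ _ u' => cases u.unique u' trivial trivial
      | recv _ _ _ _ u' => cases u.unique u' trivial trivial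
      | run _ _ _ u' => cases u.unique u' trivial trivial
      | select _ _ _ _ u' => cases u.unique u' trivial trivial
      | branch _ _ _ i u' =>
        cases u.unique u' trivial trivial
        obtain ⟨w, hw⟩ := hQ
        obtain ⟨w', hw', -⟩ := hw.2.1 ⟨rfl, rfl⟩
        -- The label at the front is the one in transit, so the additional branches of the receiver
        -- are never taken.
        have hij : i.1 = j.1 := by simpa using (List.append_inj' hw' rfl).2
        rw [hij]
        exact ⟨_, .branch _ _ _ j _⟩
    · simp only [firstDepth, h₁, if_false] at hn
      obtain ⟨G', h⟩ := ih (Nat.lt_of_succ_lt_succ hn) hG.2.2.2 (hL.2 h₁)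
        (hQ.imp fun _ _ h => h.2.2 fun h => h₁ (hs ▸ h.2))
      exact ⟨_, .underChoiceSent _ _ _ j _ _ (Function.update G j G')
        (by rwa [Function.update_self]) (hs ▸ h₁)
        fun i hi => (Function.update_of_ne hi _ _).symm⟩
  | eval p τ c G =>
    by_cases h₁ : r = p
    · obtain ⟨M, u, -⟩ := hL.1 h₁
      subst h₁
      cases ha with
      | send _ _ _ u' => cases u.unique u' trivial trivial
      | recv _ _ _ _ u' => cases u.unique u' trivial trivial
      | run _ _ _ u' => cases u.unique u' trivial trivial; exact ⟨_, .run _ _ _ _⟩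
      | select _ _ _ _ u' => cases u.unique u' trivial trivial
      | branch _ _ _ _ u' => cases u.unique u' trivial trivial
    · simp only [firstDepth, h₁, if_false] at hn
      obtain ⟨G', h⟩ := ih (Nat.lt_of_succ_lt_succ hn) hG.2 (hL.2 h₁)
        (hQ.imp fun _ _ h => h.2)
      exact ⟨_, .underEval _ _ _ _ _ _ h (hs ▸ h₁)⟩

end GType

/-! ### The bisimulation -/

namespace Config

variable {Ty : Type u} {Cost : Type v} {R : Finset ℕ}

/-- Splits a configuration step into its effect on one local type and on each queue, the two
components that the invariant treats separately. -/
theorem Step.acts {K K' : Config Ty Cost R} {a : Act Ty Cost} (h : Step K a K') :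
    ∃ r : {p // p ∈ R}, LType.Acts r (K.types r) a (K'.types r) ∧
      (∀ p, p ≠ r → K'.types p = K.types p) ∧
      ∀ s q : {p // p ∈ R}, a.OnQueue s q (K.queues (s, q)) (K'.queues (s, q)) := by
  cases h with
  | send C Q p q τ L u =>
    refine ⟨p, ?_, fun x hx => Function.update_of_ne hx _ _, fun s r => ?_⟩
    · simpa using LType.Acts.send _ _ _ u
    · by_cases hc : s = p ∧ r = q
      · obtain ⟨rfl, rfl⟩ := hc
        simp [Act.OnQueue]
      · simp [Act.OnQueue, hc]
  | recv C Q p q τ c L w u hQ =>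
    refine ⟨p, ?_, fun x hx => Function.update_of_ne hx _ _, fun s r => ?_⟩
    · simpa using LType.Acts.recv _ _ _ _ u
    · by_cases hc : s = q ∧ r = p
      · obtain ⟨rfl, rfl⟩ := hc
        simp [Act.OnQueue, hQ]
      · simp [Act.OnQueue, hc]
  | run C Q p τ c L u =>
    refine ⟨p, ?_, fun x hx => Function.update_of_ne hx _ _, fun s r => rfl⟩
    simpa using LType.Acts.run _ _ _ u
  | select C Q p q I L i u =>
    refine ⟨p, ?_, fun x hx => Function.update_of_ne hx _ _, fun s r => ?_⟩
    · simpa using LType.Acts.select _ _ _ i u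
    · by_cases hc : s = p ∧ r = q
      · obtain ⟨rfl, rfl⟩ := hc
        simp [Act.OnQueue]
      · simp [Act.OnQueue, hc]
  | branch C Q p q I L i w u hQ =>
    refine ⟨p, ?_, fun x hx => Function.update_of_ne hx _ _, fun s r => ?_⟩
    · simpa using LType.Acts.branch _ _ _ i u
    · by_cases hc : s = q ∧ r = p
      · obtain ⟨rfl, rfl⟩ := hc
        simp [Act.OnQueue, hQ]
      · simp [Act.OnQueue, hc]

theorem exists_step {K : Config Ty Cost R} {a : Act Ty Cost} {r : {p // p ∈ R}}
    {L : LType Ty Cost} (hR : a.RolesIn R) (ha : LType.Acts r (K.types r) a L)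
    (hQ : ∀ s q : {p // p ∈ R}, ∃ w, a.OnQueue s q (K.queues (s, q)) w) :
    ∃ K', Step K a K' := by
  obtain ⟨C, Q⟩ := K
  cases ha with
  | send q τ _ u =>
    exact ⟨_, .send C Q r ⟨q, hR.2⟩ τ L u⟩
  | recv q τ c L u =>
    obtain ⟨w, hw⟩ := hQ ⟨q, hR.1⟩ r
    simp only [Act.OnQueue, and_self, if_true] at hw
    exact ⟨_, .recv C Q r ⟨q, hR.1⟩ τ c L w u hw⟩
  | run τ c _ u => exact ⟨_, .run C Q r τ c L u⟩
  | select q I L i u =>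
    exact ⟨_, .select C Q r ⟨q, hR.2⟩ I L i u⟩
  | branch q I L i u =>
    obtain ⟨w, hw⟩ := hQ ⟨q, hR.1⟩ r
    simp only [Act.OnQueue, and_self, if_true] at hw
    exact ⟨_, .branch C Q r ⟨q, hR.1⟩ I L i w u hw⟩

/-- The configuration `K` implements the global type `G`. -/
structure Realizes (K : Config Ty Cost R) (G : GType Ty Cost) : Prop where
  wf : G.WF R
  types : ∀ r : {p // p ∈ R}, GType.Implements r (K.types r) G
  queues : ∀ s r : {p // p ∈ R}, GType.QueueOf s r G (K.queues (s, r))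

/-- The global step predicts a successor type for the subject and a successor for every queue; by
determinism these are the components of `K'`. Thus any two steps with the same action restore the
invariant, which serves both directions of the bisimulation. -/
theorem Realizes.of_step {K K' : Config Ty Cost R} {G G' : GType Ty Cost}
    {a : Act Ty Cost} (h : K.Realizes G) (hK : Step K a K') (hG : GType.Step G a G') :
    K'.Realizes G' := by
  obtain ⟨r, ha, hne, hQ⟩ := hK.acts
  have hs := ha.subj
  refine ⟨(hG.wf h.wf).1, fun p => ?_, fun s q => ?_⟩
  · by_cases hp : p = r
    · subst hp
      obtain ⟨L', ha', hi⟩ := hG.exists_acts h.wf (hs ▸ h.types p)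
      rw [hs] at ha' hi
      rwa [ha.unique ha']
    · rw [hne p hp]
      exact hG.implements_of_ne h.wf (fun e => hp (Subtype.ext (e.trans hs))) (h.types p)
  · obtain ⟨w, hw, hq⟩ := hG.exists_onQueue h.wf (h.queues s q)
    rwa [(hQ s q).unique hw]

theorem Realizes.exists_step {K : Config Ty Cost R} {G G' : GType Ty Cost}
    {a : Act Ty Cost} (h : K.Realizes G) (hG : GType.Step G a G') :
    ∃ K', Step K a K' ∧ K'.Realizes G' := by
  have hR := (hG.wf h.wf).2
  have hr : a.subj ∈ R := by
    cases a with
    | send => exact hR.1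
    | recv => exact hR.2
    | select => exact hR.1
    | branch => exact hR.2
    | run => exact hR
  obtain ⟨L, ha, -⟩ := hG.exists_acts h.wf (h.types ⟨_, hr⟩)
  obtain ⟨K', hK⟩ := Config.exists_step (r := ⟨_, hr⟩) hR ha fun s q =>
    (hG.exists_onQueue h.wf (h.queues s q)).imp fun _ h => h.1
  exact ⟨K', hK, h.of_step hK hG⟩

theorem Realizes.exists_global_step {K K' : Config Ty Cost R} {G : GType Ty Cost}
    {a : Act Ty Cost} (h : K.Realizes G) (hK : Step K a K') :
    ∃ G', GType.Step G a G' ∧ K'.Realizes G' := by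
  obtain ⟨r, ha, -, -⟩ := hK.acts
  have hQ : G.Ready a := by
    cases hK with
    | send => trivial
    | recv C Q p q τ c L w u hQ => exact ⟨w, hQ ▸ h.queues q p⟩
    | run => trivial
    | select => trivial
    | branch C Q p q I L i w u hQ => exact ⟨w, hQ ▸ h.queues q p⟩
  obtain ⟨G', hG⟩ := GType.exists_step_of_acts _ (Nat.lt_succ_self _) h.wf (h.types r) ha hQ
  exact ⟨G', hG, h.of_step hK hG⟩

theorem Realizes.traceEquiv {K : Config Ty Cost R} {G : GType Ty Cost} (h : K.Realizes G) :
    TraceEquiv G K := by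
  ext t
  constructor
  · rintro ⟨G', hG⟩
    induction hG generalizing K with
    | nil => exact ⟨_, .nil _⟩
    | cons G a G₁ t G₂ hs _ ih =>
      obtain ⟨K₁, hK, h₁⟩ := h.exists_step hs
      obtain ⟨K₂, hr⟩ := ih h₁
      exact ⟨K₂, .cons _ _ _ _ _ hK hr⟩
  · rintro ⟨K', hK⟩
    induction hK generalizing G with
    | nil => exact ⟨_, .nil _⟩
    | cons K a K₁ t K₂ hs _ ih =>
      obtain ⟨G₁, hG, h₁⟩ := h.exists_global_step hs
      obtain ⟨G₂, hr⟩ := ih h₁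
      exact ⟨G₂, .cons _ _ _ _ _ hG hr⟩

end Config

theorem theorem3p4 {Ty : Type u} {Cost : Type v} (G : GType Ty Cost)
    (hclosed : G.Closed) (hguarded : G.Guarded) (hproper : G.ProperInteractions)
    (hvar : ∀ p ∈ G.roles, G.NoForeignVar p)
    (C : {p // p ∈ G.roles} → LType Ty Cost)
    (hC : ∀ p : {p // p ∈ G.roles}, Proj p.1 G (C p)) :
    TraceEquiv G (⟨C, fun _ => []⟩ : Config Ty Cost G.roles) := by
  have hG : G.StaticWF G.roles 0 :=
    GType.staticWF_of_proj (Finset.Subset.refl _) hclosed hproper fun p hp => ⟨_, hC ⟨p, hp⟩⟩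
  exact Config.Realizes.traceEquiv ⟨hG.wf,
    fun r => ((hC r).staticProj hproper (hvar r r.2)).implements hG (.rfl _),
    fun _ _ => hG.queueOf_nil⟩
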